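/- All graphs are finite and simple. For a connected graph $G$, a set $R$ of edges is a $u$-$v$-rainbow-cut of an edge-coloring of $G$ (adjacent edges may share a color) if no two edges of $R$ have the same color and $u,v$ lie in different components of $G-R$. The rainbow disconnection number $\mathrm{rd}(G)$ is the least number of colors in an edge-coloring of $G$ for which every two distinct vertices $u,v$ are separated by a $u$-$v$-rainbow-cut. Write $N(u)$ for the set of neighbors of $u$, $N[u]=N(u)\cup\{u\}$, and $\Delta(G)$ for the maximum degree. Theorem. Let $G$ be a graph of order $n\ge 4$ with vertex set $V$ such that both $G$ and its complement $\overline{G}$ are connected. Each of the two equalities $\mathrm{rd}(G)+\mathrm{rd}(\overline{G})=2n-5$ and $\mathrm{rd}(G)\cdot\mathrm{rd}(\overline{G})=(n-2)(n-3)$ holds if and only if at least one $H\in\{G,\overline{G}\}$ satisfies all three of the following conditions (neighborhoods and degrees taken in $H$). (1) $\Delta(H)=n-2$ and one of the following holds: (a) there are two nonadjacent vertices of degree $n-2$ in $H$; or (b) any two distinct vertices of degree $n-2$ in $H$ are adjacent, and for some pair $u\neq v$ of vertices of degree $n-2$ there is either a vertex $z\notin N(u)\cup N(v)$, or two distinct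 vertices $x\in N(u)\setminus N[v]$ and $y\in N(v)\setminus N[u]$ that belong to the same component of $H[V\setminus\{u,v\}]$. (2) $H$ has exactly two vertices of degree $n-2$, say $u$ and $v$. (3) With $u,v$ as in (2), $H$ has at least two vertices of degree $2$ that lie neither in $N(u)\setminus N[v]$, nor in $N(v)\setminus N[u]$, nor outside $N(u)\cup N(v)$. -/

import Mathlib

/-- `F` is an edge-cut of `G`: a set of edges such that `G - F` is disconnected. -/
def IsEdgeCut {V : Type*} (G : SimpleGraph V) (F : Set G.edgeSet) : Prop :=
  ¬ (G.deleteEdges (Subtype.val '' F)).Connected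

/-- `R` is a `u`-`v`-rainbow-cut of `G` under the edge-colouring `c`: an edge-cut, no two of whose
edges have the same colour, such that `u` and `v` lie in different components of `G - R`. -/
structure IsRainbowCutBetween {V : Type*} (G : SimpleGraph V) {k : ℕ} (c : G.edgeSet → Fin k)
    (R : Set G.edgeSet) (u v : V) : Prop where
  isEdgeCut : IsEdgeCut G R
  rainbow : Set.InjOn c R
  separates : ¬ (G.deleteEdges (Subtype.val '' R)).Reachable u v

/-- `c` is a rainbow disconnection colouring of `G`: any two distinct vertices are separated by
a rainbow-cut. -/
def IsRainbowDisconnection {V : Type*} (G : SimpleGraph V) {k : ℕ} (c : G.edgeSet → Fin k) :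
    Prop :=
  ∀ u v : V, u ≠ v → ∃ R : Set G.edgeSet, IsRainbowCutBetween G c R u v

/-- A finite graph has a rainbow disconnection colouring: give all edges different colours. -/
theorem exists_isRainbowDisconnection {V : Type*} [Finite V] (G : SimpleGraph V) :
    ∃ (k : ℕ) (c : G.edgeSet → Fin k), IsRainbowDisconnection G c := by
  obtain ⟨k, ⟨e⟩⟩ := Finite.exists_equiv_fin G.edgeSet
  refine ⟨k, e, fun u v huv => ⟨Set.univ, ?_⟩⟩
  have h : ¬ (G.deleteEdges (Subtype.val '' (Set.univ : Set G.edgeSet))).Reachable u v := by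
    have h0 : G.deleteEdges (Subtype.val '' (Set.univ : Set G.edgeSet)) = ⊥ := by
      simp
    rw [h0, SimpleGraph.reachable_bot]
    exact huv
  exact ⟨fun hc => h (hc.preconnected u v), e.injective.injOn, h⟩

/-- The rainbow disconnection number `rd(G)`: the least number of colours in a rainbow
disconnection colouring of `G`. -/
noncomputable def rd {V : Type*} (G : SimpleGraph V) : ℕ :=
  sInf {k : ℕ | ∃ c : G.edgeSet → Fin k, IsRainbowDisconnection G c}

/-- `Δ(G) = n - 2` and there are two nonadjacent vertices of degree `n - 2`. -/
def NonadjacentCondition {V : Type*} [Fintype V] (G : SimpleGraph V) [DecidableRel G.Adj] :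
    Prop :=
  G.maxDegree = Fintype.card V - 2 ∧
    ∃ u v : V, u ≠ v ∧ G.degree u = Fintype.card V - 2 ∧ G.degree v = Fintype.card V - 2 ∧
      ¬ G.Adj u v

/-- `Δ(G) = n - 2`, any two vertices of degree `n - 2` are adjacent, and for some pair `u, v` of
vertices of degree `n - 2` either there is a vertex `z ∉ N(u) ∪ N(v)`, or there are two distinct
vertices `x ∈ N(u) \ N[v]` and `y ∈ N(v) \ N[u]` in the same component of `G[V \ {u, v}]`. -/
def AdjacentCondition {V : Type*} [Fintype V] (G : SimpleGraph V) [DecidableRel G.Adj] :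
    Prop :=
  G.maxDegree = Fintype.card V - 2 ∧
    (∀ u v : V, u ≠ v → G.degree u = Fintype.card V - 2 → G.degree v = Fintype.card V - 2 →
      G.Adj u v) ∧
    ∃ u v : V, u ≠ v ∧ G.degree u = Fintype.card V - 2 ∧ G.degree v = Fintype.card V - 2 ∧
      ((∃ z : V, z ∉ G.neighborSet u ∪ G.neighborSet v) ∨
        ∃ x y : V, x ≠ y ∧
          x ∈ G.neighborSet u \ insert v (G.neighborSet v) ∧
          y ∈ G.neighborSet v \ insert u (G.neighborSet u) ∧
          ∃ (hx : x ∈ ({u, v} : Set V)ᶜ) (hy : y ∈ ({u, v} : Set V)ᶜ),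
            (G.induce ({u, v} : Set V)ᶜ).Reachable ⟨x, hx⟩ ⟨y, hy⟩)

/-- `w` is one of the special vertices `x`, `y`, `z` for the pair `u, v`:
`x ∈ N(u) \ N[v]`, `y ∈ N(v) \ N[u]`, `z ∉ N(u) ∪ N(v)`. -/
def IsSpecialVertex {V : Type*} (G : SimpleGraph V) (u v w : V) : Prop :=
  w ∈ G.neighborSet u \ insert v (G.neighborSet v) ∨
    w ∈ G.neighborSet v \ insert u (G.neighborSet u) ∨
    w ∉ G.neighborSet u ∪ G.neighborSet v

/-- The three conditions of the characterization: one of the two conditions above holds; there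
are exactly two vertices `u, v` of degree `n - 2`; and at least two vertices of degree `2` are
none of the special vertices `x`, `y`, `z` for `u, v`. -/
def ExtremalConditions {V : Type*} [Fintype V] (G : SimpleGraph V) [DecidableRel G.Adj] :
    Prop :=
  (NonadjacentCondition G ∨ AdjacentCondition G) ∧
    ∃ u v : V, u ≠ v ∧ {w : V | G.degree w = Fintype.card V - 2} = {u, v} ∧
      2 ≤ {w : V | G.degree w = 2 ∧ ¬ IsSpecialVertex G u v w}.ncard

/-!
For connected `G` and `Gᶜ` on `n ≥ 4` vertices, all degrees are at most `n - 2`, which implies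
`rd G ≤ n - 2` and `rd Gᶜ ≤ n - 2` (`rd_le_of_degree_le`). Given these bounds, each of the two
equalities says that one of the numbers is `n - 2` and the other one is `n - 3`. It remains to
show that the extremal conditions for `G` mean `rd G = n - 2` and `rd Gᶜ = n - 3`
(`extremalConditions_iff`).

*Upper bounds.* If an edge-colouring is proper at all vertices but one, then the edges at a vertex
provide all the rainbow cuts needed. Such a colouring arises from a proper colouring of `G - w` by
giving each edge at `w` a colour missing at its other end (`exists_isProperExceptAt`). For
`G - w` a sharpening of Vizing's theorem is used: `k` colours suffice if the maximum degree is at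
most `k` and at most two vertices have degree `k` (`exists_isProperEdgeColoring`). Its proof adds
the vertices one at a time, following Ehrenfeucht, Faber and Kierstead
(`exists_recoloring_of_card_missing`). When `w` has maximum degree and `G` has at most `k + 3`
vertices, `w` has at most two non-neighbours, whence `rd G ≤ k`. Pendant vertices can be ignored
here (`rd_le_of_center`, `rd_le_of_ncard_neighborSet_le`).

Consequently `rd G ≤ n - 3` unless `G` has two vertices `u` and `v` of degree `n - 2`. If any two
such vertices are adjacent and the condition on common non-neighbours and components fails, then
`u` and `v` are the only vertices of degree `n - 2`, and their non-neighbours lie in different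
components of `G - u - v`; there is a cut of `n - 3` edges between `u` and `v`, which can be made
rainbow (`rd_le_of_disconnected`). So `rd G = n - 2` forces the first condition
(`rd_le_or_condition`).

*Lower bounds.* A cut between adjacent vertices has at least as many edges as these have common
neighbours, plus one, plus one more if a path avoids the common neighbours
(`le_rd_of_common_neighbors`, `le_rd_of_common_neighbors_of_path`). Hence the first condition
forces `rd G = n - 2`.

*The complement.* The vertices of degree `n - 2` of `G` are pendant in `Gᶜ`. If there are three of
them, then `rd Gᶜ ≤ n - 4`. If there are exactly two, `u` and `v`, then `rd Gᶜ = n - 3` holds if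
and only if two vertices of `Gᶜ - u - v` are adjacent to all others there. As the special vertices
have a neighbour besides `u` and `v` in `G`, these are exactly the vertices of the third condition.
-/

/-! ### Proper edge-colourings and Kempe exchanges -/

/-- A symmetric function `f` is a proper edge-colouring of `G` with colours in `S`. Only the values
of `f` on edges matter. -/
structure IsProperEdgeColoring {V : Type*} (G : SimpleGraph V) (S : Finset ℕ) (f : V → V → ℕ) :
    Prop where
  symm : ∀ a b, f a b = f b a
  mem : ∀ a b, G.Adj a b → f a b ∈ S
  inj : ∀ a b c, G.Adj a b → G.Adj a c → f a b = f a c → b = c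

/-- No edge of `G` at the vertex `a` has colour `i`. -/
def IsMissingColor {V : Type*} (G : SimpleGraph V) (f : V → V → ℕ) (a : V) (i : ℕ) : Prop :=
  ∀ b, G.Adj a b → f a b ≠ i

/-- A connected graph of maximum degree at most two has at most two vertices of degree at most
one, because it has at least as many edges as it has vertices, minus one. -/
theorem card_le_two_of_connected_of_degree_le_one {W : Type*} [Fintype W] [DecidableEq W]
    {H : SimpleGraph W} [DecidableRel H.Adj] (hH : H.Connected) (h2 : ∀ v, H.degree v ≤ 2)
    (D : Finset W) (hD : ∀ v ∈ D, H.degree v ≤ 1) : D.card ≤ 2 := by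
  have h := hH.card_vert_le_card_edgeSet_add_one
  rw [Nat.card_eq_fintype_card, Nat.card_eq_fintype_card, ← SimpleGraph.edgeFinset_card] at h
  have hs := H.sum_degrees_eq_twice_card_edges
  have hle : ∑ v, (H.degree v + if v ∈ D then 1 else 0) ≤ ∑ _v : W, 2 := by
    refine Finset.sum_le_sum fun v _ => ?_
    split_ifs with hv
    · have := hD v hv
      omega
    · exact h2 v
  rw [Finset.sum_add_distrib, hs] at hle
  simp at hle
  omega

/-- In a graph of maximum degree at most two, each component has at most two vertices of degree
at most one. -/
theorem card_le_two_of_component {V : Type*} [Finite V] {K : SimpleGraph V}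
    (h2 : ∀ v, (K.neighborSet v).ncard ≤ 2) (C : K.ConnectedComponent) (D : Finset V)
    (hC : ∀ v ∈ D, v ∈ C.supp) (hD : ∀ v ∈ D, (K.neighborSet v).ncard ≤ 1) : D.card ≤ 2 := by
  classical
  have := Fintype.ofFinite V
  have hdeg : ∀ v : C, C.toSimpleGraph.degree v ≤ (K.neighborSet v).ncard := by
    intro v
    rw [← SimpleGraph.card_neighborSet_eq_degree, ← Nat.card_eq_fintype_card]
    refine (Set.ncard_image_of_injective (C.toSimpleGraph.neighborSet v)
      Subtype.val_injective).symm.le.trans (Set.ncard_le_ncard ?_ (Set.toFinite _))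
    rintro _ ⟨w, hw, rfl⟩
    exact hw
  have h := card_le_two_of_connected_of_degree_le_one C.connected_toSimpleGraph
    (fun v => (hdeg v).trans (h2 v)) (D.subtype (· ∈ C)) (fun v hv => (hdeg v).trans
      (hD v (Finset.mem_subtype.1 hv)))
  rwa [Finset.card_subtype, Finset.filter_true_of_mem (p := (· ∈ C)) hC] at h

/-- The edges with colour `i` or `j`. -/
def kempeGraph {V : Type*} (G : SimpleGraph V) (f : V → V → ℕ) (hf : ∀ a b, f a b = f b a)
    (i j : ℕ) : SimpleGraph V where
  Adj a b := G.Adj a b ∧ (f a b = i ∨ f a b = j)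
  symm := ⟨fun a b h => ⟨h.1.symm, by rw [hf b a]; exact h.2⟩⟩
  loopless := ⟨fun a h => G.loopless.irrefl a h.1⟩

open Classical in
/-- The permutation of the colours performed at the vertex `a` by the Kempe exchange of `i` and
`j` on the component `C`. -/
noncomputable def kempePerm {V : Type*} {K : SimpleGraph V} (C : K.ConnectedComponent)
    (i j : ℕ) (a : V) : Equiv.Perm ℕ :=
  if a ∈ C.supp then Equiv.swap i j else 1

open Classical in
/-- The colouring obtained from `f` by a Kempe exchange. -/
noncomputable def kempeExchange {V : Type*} (G : SimpleGraph V) (f : V → V → ℕ)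
    {K : SimpleGraph V} (C : K.ConnectedComponent) (i j : ℕ) (a b : V) : ℕ :=
  if G.Adj a b then kempePerm C i j a (f a b) else f a b

section Kempe

variable {V : Type*} {G : SimpleGraph V} {S : Finset ℕ} {f : V → V → ℕ}

theorem kempePerm_mem {K : SimpleGraph V} (C : K.ConnectedComponent) {i j l : ℕ} (hi : i ∈ S)
    (hj : j ∈ S) (a : V) (hl : l ∈ S) : kempePerm C i j a l ∈ S := by
  unfold kempePerm
  split_ifs
  · rw [Equiv.swap_apply_def]
    split_ifs <;> assumption
  · exact hl

theorem kempeExchange_isProperEdgeColoring (hf : IsProperEdgeColoring G S f) {i j : ℕ}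
    (hi : i ∈ S) (hj : j ∈ S) (C : (kempeGraph G f hf.symm i j).ConnectedComponent) :
    IsProperEdgeColoring G S (kempeExchange G f C i j) where
  symm a b := by
    unfold kempeExchange
    by_cases hab : G.Adj a b
    · rw [if_pos hab, if_pos hab.symm, hf.symm b a]
      by_cases hc : f a b = i ∨ f a b = j
      · have hK : (kempeGraph G f hf.symm i j).Adj a b := ⟨hab, hc⟩
        have : a ∈ C.supp ↔ b ∈ C.supp := by
          rw [SimpleGraph.ConnectedComponent.mem_supp_iff,
            SimpleGraph.ConnectedComponent.mem_supp_iff,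
            SimpleGraph.ConnectedComponent.sound hK.reachable]
        unfold kempePerm
        by_cases ha : a ∈ C.supp
        · rw [if_pos ha, if_pos (this.1 ha)]
        · rw [if_neg ha, if_neg (fun hb => ha (this.2 hb))]
      · push Not at hc
        unfold kempePerm
        split_ifs <;> simp [Equiv.swap_apply_of_ne_of_ne hc.1 hc.2]
    · rw [if_neg hab, if_neg (fun h => hab h.symm), hf.symm]
  mem a b hab := by
    rw [kempeExchange, if_pos hab]
    exact kempePerm_mem C hi hj a (hf.mem a b hab)
  inj a b c hab hac h := by
    rw [kempeExchange, kempeExchange, if_pos hab, if_pos hac] at h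
    exact hf.inj a b c hab hac ((kempePerm C i j a).injective h)

theorem kempeExchange_isMissingColor {K : SimpleGraph V} (C : K.ConnectedComponent) {i j l : ℕ}
    {a : V} (h : IsMissingColor G f a l) :
    IsMissingColor G (kempeExchange G f C i j) a (kempePerm C i j a l) := by
  intro b hab
  rw [kempeExchange, if_pos hab]
  exact fun he => h b hab ((kempePerm C i j a).injective he)

theorem ncard_neighborSet_kempeGraph_le_two [Finite V] (hf : IsProperEdgeColoring G S f)
    (i j : ℕ) (a : V) : ((kempeGraph G f hf.symm i j).neighborSet a).ncard ≤ 2 := by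
  have hinj : Set.InjOn (f a) ((kempeGraph G f hf.symm i j).neighborSet a) :=
    fun b hb c hc h => hf.inj a b c hb.1 hc.1 h
  rw [← hinj.ncard_image]
  refine (Set.ncard_le_ncard (t := {i, j}) ?_ (Set.toFinite _)).trans
    ((Set.ncard_insert_le i {j}).trans (by simp))
  rintro _ ⟨b, hb, rfl⟩
  exact hb.2

theorem ncard_neighborSet_kempeGraph_le_one [Finite V] (hf : IsProperEdgeColoring G S f)
    (i j : ℕ) (a : V) (ha : IsMissingColor G f a i) :
    ((kempeGraph G f hf.symm i j).neighborSet a).ncard ≤ 1 := by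
  rw [Set.ncard_le_one_iff]
  intro b c hb hc
  refine hf.inj a b c hb.1 hc.1 ?_
  rw [hb.2.resolve_left (ha b hb.1), hc.2.resolve_left (ha c hc.1)]

end Kempe

/-! ### Extending an edge-colouring to a new vertex -/

/-- Each vertex `u ∈ N` is assigned a set `Y u` of colours missing at `u`: one colour if `u = u₀`,
two colours otherwise. The vertices of `N` are those which are to be joined to a new vertex. -/
structure IsColorReserve {V : Type*} [DecidableEq V] (G : SimpleGraph V) (S : Finset ℕ)
    (f : V → V → ℕ) (N : Finset V) (u₀ : V) (Y : V → Finset ℕ) : Prop where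
  proper : IsProperEdgeColoring G S f
  subset : ∀ u ∈ N, Y u ⊆ S
  missing : ∀ u ∈ N, ∀ i ∈ Y u, IsMissingColor G f u i
  card : ∀ u ∈ N, (Y u).card = if u = u₀ then 1 else 2

/-- The vertices of `N` that have the colour `i` in reserve. -/
def reserveClass {V : Type*} (N : Finset V) (Y : V → Finset ℕ) (i : ℕ) : Finset V :=
  N.filter fun u => i ∈ Y u

section Reserve

variable {V : Type*} [DecidableEq V] {G : SimpleGraph V} {S : Finset ℕ} {f : V → V → ℕ}
  {N : Finset V} {u₀ : V} {Y : V → Finset ℕ}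

/-- If the class of `i` has at least three elements more than the class of `j`, then some
`i`-`j`-Kempe component contains more elements of the former than of the latter; it contains at
most two elements of the former, so that the exchange makes the two classes more equal. -/
theorem IsColorReserve.exists_lt [Finite V] (h : IsColorReserve G S f N u₀ Y) {i j : ℕ}
    (hi : i ∈ S) (hj : j ∈ S) (hlt : (reserveClass N Y j).card + 2 < (reserveClass N Y i).card) :
    ∃ f' Y', IsColorReserve G S f' N u₀ Y' ∧
      ∑ l ∈ S, (reserveClass N Y' l).card ^ 2 < ∑ l ∈ S, (reserveClass N Y l).card ^ 2 := by
  classical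
  have hij : i ≠ j := by
    rintro rfl
    omega
  let K := kempeGraph G f h.proper.symm i j
  let T := N.image K.connectedComponentMk
  have hfib : ∀ l, (reserveClass N Y l).card =
      ∑ C ∈ T, ((reserveClass N Y l).filter fun u => K.connectedComponentMk u = C).card := by
    intro l
    refine Finset.card_eq_sum_card_fiberwise fun u hu => ?_
    exact Finset.mem_coe.2 (Finset.mem_image_of_mem _ (Finset.mem_filter.1 hu).1)
  obtain ⟨C, -, hC⟩ : ∃ C ∈ T,
      ((reserveClass N Y j).filter fun u => K.connectedComponentMk u = C).card <
      ((reserveClass N Y i).filter fun u => K.connectedComponentMk u = C).card := by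
    refine Finset.exists_lt_of_sum_lt ?_
    rw [← hfib, ← hfib]
    omega
  have hle : ((reserveClass N Y i).filter fun u => K.connectedComponentMk u = C).card ≤ 2 := by
    refine card_le_two_of_component (ncard_neighborSet_kempeGraph_le_two h.proper i j) C _ ?_ ?_
    · intro v hv
      exact (Finset.mem_filter.1 hv).2
    · intro v hv
      have hv' := Finset.mem_filter.1 (Finset.mem_filter.1 hv).1
      exact ncard_neighborSet_kempeGraph_le_one h.proper i j v (h.missing v hv'.1 i hv'.2)
  let Y' : V → Finset ℕ := fun u => (Y u).map (kempePerm C i j u).toEmbedding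
  have hmem : ∀ u l, kempePerm C i j u l ∈ Y' u ↔ l ∈ Y u := by
    intro u l
    simp [Y']
  have hin : ∀ u, K.connectedComponentMk u = C → kempePerm C i j u = Equiv.swap i j :=
    fun u hu => if_pos hu
  have hout : ∀ u, ¬ K.connectedComponentMk u = C → kempePerm C i j u = 1 :=
    fun u hu => if_neg hu
  have hcount : ∀ l l', Equiv.swap i j l' = l →
      (reserveClass N Y' l).card +
        ((reserveClass N Y l).filter fun u => K.connectedComponentMk u = C).card =
      (reserveClass N Y l).card +
        ((reserveClass N Y l').filter fun u => K.connectedComponentMk u = C).card := by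
    intro l l' hl
    rw [← Finset.card_filter_add_card_filter_not (s := reserveClass N Y' l)
      (fun u => K.connectedComponentMk u = C), ← Finset.card_filter_add_card_filter_not
      (s := reserveClass N Y l) (fun u => K.connectedComponentMk u = C)]
    have h1 : (reserveClass N Y' l).filter (fun u => K.connectedComponentMk u = C) =
        (reserveClass N Y l').filter fun u => K.connectedComponentMk u = C := by
      ext u
      simp only [reserveClass, Finset.mem_filter]
      refine and_congr_left fun hu => and_congr_right fun _ => ?_
      rw [← hmem u l', hin u hu, hl]
    have h2 : (reserveClass N Y' l).filter (fun u => ¬ K.connectedComponentMk u = C) =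
        (reserveClass N Y l).filter fun u => ¬ K.connectedComponentMk u = C := by
      ext u
      simp only [reserveClass, Finset.mem_filter]
      refine and_congr_left fun hu => and_congr_right fun _ => ?_
      rw [← hmem u l, hout u hu, Equiv.Perm.one_apply]
    rw [h1, h2]
    omega
  refine ⟨kempeExchange G f C i j, Y', ⟨?_, ?_, ?_, ?_⟩, ?_⟩
  · exact kempeExchange_isProperEdgeColoring h.proper hi hj C
  · intro u hu l hl
    obtain ⟨l', hl', rfl⟩ := Finset.mem_map.1 hl
    exact kempePerm_mem C hi hj u (h.subset u hu hl')
  · intro u hu l hl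
    obtain ⟨l', hl', rfl⟩ := Finset.mem_map.1 hl
    exact kempeExchange_isMissingColor C (h.missing u hu l' hl')
  · intro u hu
    rw [Finset.card_map]
    exact h.card u hu
  · have hjS : j ∈ S.erase i := Finset.mem_erase.2 ⟨hij.symm, hj⟩
    have hrest : ∑ l ∈ (S.erase i).erase j, (reserveClass N Y' l).card ^ 2 =
        ∑ l ∈ (S.erase i).erase j, (reserveClass N Y l).card ^ 2 := by
      refine Finset.sum_congr rfl fun l hl => ?_
      simp only [Finset.mem_erase] at hl
      have := hcount l l (Equiv.swap_apply_of_ne_of_ne hl.2.1 hl.1)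
      rw [Nat.add_right_cancel this]
    rw [← Finset.add_sum_erase S _ hi, ← Finset.add_sum_erase _ _ hjS, hrest,
      ← Finset.add_sum_erase S _ hi, ← Finset.add_sum_erase _ _ hjS, ← add_assoc, ← add_assoc]
    refine Nat.add_lt_add_right ?_ _
    have e1 := hcount i j (Equiv.swap_apply_right i j)
    have e2 := hcount j i (Equiv.swap_apply_left i j)
    generalize ((reserveClass N Y j).filter fun u => K.connectedComponentMk u = C).card = b at *
    generalize ((reserveClass N Y i).filter fun u => K.connectedComponentMk u = C).card = a at *
    obtain ⟨d, rfl⟩ := Nat.exists_eq_add_of_lt hC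
    generalize (reserveClass N Y' i).card = p at *
    generalize (reserveClass N Y' j).card = q at *
    generalize (reserveClass N Y j).card = y at *
    obtain rfl : q = y + (d + 1) := by omega
    have e3 : (reserveClass N Y i).card = p + (d + 1) := by omega
    rw [e3] at hlt ⊢
    nlinarith

/-- After suitable Kempe exchanges the sizes of the classes differ by at most two. -/
theorem IsColorReserve.exists_balanced [Finite V] (h : IsColorReserve G S f N u₀ Y) :
    ∃ f' Y', IsColorReserve G S f' N u₀ Y' ∧ ∀ i ∈ S, ∀ j ∈ S,
      (reserveClass N Y' i).card ≤ (reserveClass N Y' j).card + 2 := by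
  induction hm : ∑ l ∈ S, (reserveClass N Y l).card ^ 2 using Nat.strong_induction_on
    generalizing f Y with
  | _ m ih =>
    by_cases hb : ∀ i ∈ S, ∀ j ∈ S, (reserveClass N Y i).card ≤ (reserveClass N Y j).card + 2
    · exact ⟨f, Y, h, hb⟩
    · push Not at hb
      obtain ⟨i, hi, j, hj, hlt⟩ := hb
      obtain ⟨f', Y', h', hlt'⟩ := h.exists_lt hi hj hlt
      exact ih _ (hm ▸ hlt') h' rfl

/-- The classes have an odd total size, below twice the number of colours. Hence, if they are
balanced, one of them is a singleton. -/
theorem IsColorReserve.exists_card_eq_one (h : IsColorReserve G S f N u₀ Y) (hu₀ : u₀ ∈ N)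
    (hN : N.card ≤ S.card) (hb : ∀ i ∈ S, ∀ j ∈ S,
      (reserveClass N Y i).card ≤ (reserveClass N Y j).card + 2) :
    ∃ i ∈ S, (reserveClass N Y i).card = 1 := by
  have hsum : ∑ i ∈ S, (reserveClass N Y i).card + 1 = 2 * N.card := by
    have h1 : ∑ i ∈ S, (reserveClass N Y i).card = ∑ u ∈ N, (Y u).card := by
      simp only [reserveClass, Finset.card_filter]
      rw [Finset.sum_comm]
      refine Finset.sum_congr rfl fun u hu => ?_
      rw [← Finset.card_filter, Finset.filter_mem_eq_inter, Finset.inter_eq_right.2 (h.subset u hu)]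
    have h2 : ∑ u ∈ N, ((Y u).card + if u = u₀ then 1 else 0) = ∑ _u ∈ N, 2 := by
      refine Finset.sum_congr rfl fun u hu => ?_
      rw [h.card u hu]
      split_ifs <;> rfl
    rw [Finset.sum_add_distrib, Finset.sum_ite_eq' N u₀, if_pos hu₀, Finset.sum_const] at h2
    rw [h1, h2, smul_eq_mul, mul_comm]
  by_contra hne
  push Not at hne
  obtain ⟨j, hj, hlt⟩ : ∃ j ∈ S, (reserveClass N Y j).card < 2 := by
    by_contra hge
    push Not at hge
    have := Finset.card_nsmul_le_sum S _ 2 hge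
    rw [smul_eq_mul] at this
    omega
  have hj0 : (reserveClass N Y j).card = 0 := by
    have := hne j hj
    omega
  have heven : 2 ∣ ∑ i ∈ S, (reserveClass N Y i).card := by
    refine Finset.dvd_sum fun i hi => ?_
    have h1 := hb i hi j hj
    have h2 := hne i hi
    have h3 : (reserveClass N Y i).card = 0 ∨ (reserveClass N Y i).card = 2 := by omega
    rcases h3 with h3 | h3 <;> simp [h3]
  omega

end Reserve

/-- Let `f` be a proper edge-colouring of `G` and `N` a set of at most `|S|` vertices, such that
at least two colours are missing at each vertex of `N`, with one exception, where at least one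
colour is missing. Then `G` can be recoloured so that the vertices of `N` have distinct missing
colours, that is, so that the colouring extends to a new vertex joined to `N`.

The proof is by induction on the number of colours: a balanced reserve has a colour that only one
vertex `u ∈ N` keeps in reserve. That colour is given to `u`, and its edges are set aside. -/
theorem exists_recoloring_of_card_missing {V : Type*} [Finite V] [DecidableEq V]
    (S : Finset ℕ) (G : SimpleGraph V) (f : V → V → ℕ) (N : Finset V) (u₀ : V) (Y : V → Finset ℕ)
    (hf : IsProperEdgeColoring G S f) (hN : N.card ≤ S.card) (hYS : ∀ u ∈ N, Y u ⊆ S)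
    (hY : ∀ u ∈ N, ∀ i ∈ Y u, IsMissingColor G f u i)
    (hc : ∀ u ∈ N, (if u = u₀ then 1 else 2) ≤ (Y u).card) :
    ∃ (f' : V → V → ℕ) (g : V → ℕ), IsProperEdgeColoring G S f' ∧ Set.InjOn g N ∧
      ∀ u ∈ N, g u ∈ S ∧ IsMissingColor G f' u (g u) := by
  induction hm : S.card generalizing S G f N u₀ Y with
  | zero =>
    have : N = ∅ := Finset.card_eq_zero.1 (by omega)
    subst this
    exact ⟨f, fun _ => 0, hf, by simp, by simp⟩
  | succ m ih =>
    rcases N.eq_empty_or_nonempty with rfl | hne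
    · exact ⟨f, fun _ => 0, hf, by simp, by simp⟩
    obtain ⟨v₀, hv₀, hc'⟩ : ∃ v₀ ∈ N, ∀ u ∈ N, (if u = v₀ then 1 else 2) ≤ (Y u).card := by
      by_cases h : u₀ ∈ N
      · exact ⟨u₀, h, hc⟩
      · obtain ⟨v, hv⟩ := hne
        refine ⟨v, hv, fun u hu => ?_⟩
        have := hc u hu
        rw [if_neg (by rintro rfl; exact h hu)] at this
        split_ifs <;> omega
    have hex : ∀ u, ∃ Z : Finset ℕ, u ∈ N → Z ⊆ Y u ∧ Z.card = if u = v₀ then 1 else 2 := by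
      intro u
      by_cases hu : u ∈ N
      · obtain ⟨Z, hZ⟩ := Finset.exists_subset_card_eq (hc' u hu)
        exact ⟨Z, fun _ => hZ⟩
      · exact ⟨∅, fun h => absurd h hu⟩
    choose Z hZ using hex
    have hres : IsColorReserve G S f N v₀ Z :=
      ⟨hf, fun u hu => (hZ u hu).1.trans (hYS u hu), fun u hu i hi => hY u hu i ((hZ u hu).1 hi),
        fun u hu => (hZ u hu).2⟩
    obtain ⟨f₁, Y₁, h₁, hb⟩ := hres.exists_balanced
    obtain ⟨i, hi, hone⟩ := h₁.exists_card_eq_one hv₀ hN hb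
    obtain ⟨u, hu⟩ := Finset.card_eq_one.1 hone
    have huN : u ∈ N ∧ i ∈ Y₁ u := by
      have : u ∈ reserveClass N Y₁ i := hu ▸ Finset.mem_singleton_self u
      exact Finset.mem_filter.1 this
    have huniq : ∀ w ∈ N, i ∈ Y₁ w → w = u := by
      intro w hw hiw
      have : w ∈ reserveClass N Y₁ i := Finset.mem_filter.2 ⟨hw, hiw⟩
      rw [hu] at this
      exact Finset.mem_singleton.1 this
    have hp := h₁.proper
    let G' : SimpleGraph V :=
      { Adj := fun a b => G.Adj a b ∧ f₁ a b ≠ i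
        symm := ⟨fun a b h => ⟨h.1.symm, by rw [hp.symm b a]; exact h.2⟩⟩
        loopless := ⟨fun a h => G.loopless.irrefl a h.1⟩ }
    have hp' : IsProperEdgeColoring G' (S.erase i) f₁ :=
      ⟨hp.symm, fun a b h => Finset.mem_erase.2 ⟨h.2, hp.mem a b h.1⟩,
        fun a b c hab hac h => hp.inj a b c hab.1 hac.1 h⟩
    have hcard : (S.erase i).card = m := by
      rw [Finset.card_erase_of_mem hi]
      omega
    have hcardN : (N.erase u).card ≤ (S.erase i).card := by
      rw [Finset.card_erase_of_mem huN.1, Finset.card_erase_of_mem hi]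
      omega
    obtain ⟨f₂, g, hf₂, hg, hgm⟩ := ih (S.erase i) G' f₁ (N.erase u) v₀ Y₁ hp' hcardN
      (fun w hw l hl => by
        have hw' := Finset.mem_erase.1 hw
        refine Finset.mem_erase.2 ⟨?_, h₁.subset w hw'.2 hl⟩
        rintro rfl
        exact hw'.1 (huniq w hw'.2 hl))
      (fun w hw l hl b hwb => h₁.missing w (Finset.mem_erase.1 hw).2 l hl b hwb.1)
      (fun w hw => (h₁.card w (Finset.mem_erase.1 hw).2).ge) hcard
    have hne2 : ∀ a b, G.Adj a b → f₁ a b ≠ i → f₂ a b ≠ i := fun a b hab hi' =>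
      (Finset.mem_erase.1 (hf₂.mem a b ⟨hab, hi'⟩)).1
    classical
    refine ⟨fun a b => if f₁ a b = i then i else f₂ a b, fun w => if w = u then i else g w,
      ⟨?_, ?_, ?_⟩, ?_, ?_⟩
    · intro a b
      simp only [hp.symm a b, hf₂.symm a b]
    · intro a b hab
      split_ifs with h
      · exact hi
      · exact Finset.mem_of_mem_erase (hf₂.mem a b ⟨hab, h⟩)
    · intro a b c hab hac h
      split_ifs at h with h1 h2 h2
      · exact hp.inj a b c hab hac (h1.trans h2.symm)
      · exact absurd h.symm (hne2 a c hac h2)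
      · exact absurd h (hne2 a b hab h1)
      · exact hf₂.inj a b c ⟨hab, h1⟩ ⟨hac, h2⟩ h
    · intro w hw w' hw' h
      dsimp only at h
      have hgi : ∀ z ∈ N, z ≠ u → g z ≠ i := fun z hz hzu =>
        (Finset.mem_erase.1 (hgm z (Finset.mem_erase.2 ⟨hzu, hz⟩)).1).1
      split_ifs at h with h1 h2 h2
      · exact h1.trans h2.symm
      · exact absurd h.symm (hgi w' hw' h2)
      · exact absurd h (hgi w hw h1)
      · exact hg (Finset.mem_coe.2 (Finset.mem_erase.2 ⟨h1, hw⟩))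
          (Finset.mem_coe.2 (Finset.mem_erase.2 ⟨h2, hw'⟩)) h
    · intro w hw
      dsimp only
      by_cases hwu : w = u
      · rw [if_pos hwu]
        refine ⟨hi, fun b hwb => ?_⟩
        have hmiss : f₁ w b ≠ i := by
          rw [hwu] at hwb ⊢
          exact h₁.missing u huN.1 i huN.2 b hwb
        dsimp only
        rw [if_neg hmiss]
        exact hne2 w b hwb hmiss
      · rw [if_neg hwu]
        obtain ⟨hgS, hgmis⟩ := hgm w (Finset.mem_erase.2 ⟨hwu, hw⟩)
        refine ⟨Finset.mem_of_mem_erase hgS, fun b hwb => ?_⟩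
        dsimp only
        split_ifs with h
        · exact (Finset.mem_erase.1 hgS).1.symm
        · exact hgmis b ⟨hwb, h⟩

/-- The graph `G` with all edges removed that have an end outside of `T`. The vertices outside of
`T` are kept, as isolated vertices. -/
def restrictEdges {V : Type*} (G : SimpleGraph V) (T : Set V) : SimpleGraph V where
  Adj a b := G.Adj a b ∧ a ∈ T ∧ b ∈ T
  symm := ⟨fun _ _ h => ⟨h.1.symm, h.2.2, h.2.1⟩⟩
  loopless := ⟨fun a h => G.loopless.irrefl a h.1⟩

section VertexColoring

variable {V : Type*} [Finite V] {G : SimpleGraph V}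

theorem exists_missing_colors (G : SimpleGraph V) (f : V → V → ℕ) (S : Finset ℕ) (u : V) :
    ∃ Y ⊆ S, (∀ i ∈ Y, IsMissingColor G f u i) ∧ S.card ≤ Y.card + (G.neighborSet u).ncard := by
  classical
  let U := (Set.toFinite (f u '' G.neighborSet u)).toFinset
  refine ⟨S \ U, Finset.sdiff_subset, ?_, ?_⟩
  · rintro i hi b hb rfl
    exact (Finset.mem_sdiff.1 hi).2 ((Set.Finite.mem_toFinset _).2 ⟨b, hb, rfl⟩)
  · have h1 : U.card ≤ (G.neighborSet u).ncard := by
      rw [← Set.ncard_eq_toFinset_card _ (Set.toFinite _)]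
      exact Set.ncard_image_le (Set.toFinite _)
    have h2 := Finset.le_card_sdiff U S
    omega

theorem ncard_neighborSet_restrictEdges_le (T : Set V) (u : V) :
    ((restrictEdges G T).neighborSet u).ncard ≤ (G.neighborSet u).ncard :=
  Set.ncard_le_ncard (fun _ h => h.1) (Set.toFinite _)

theorem ncard_neighborSet_restrictEdges_lt {T : Set V} {u t : V} (hut : G.Adj u t) (ht : t ∉ T) :
    ((restrictEdges G T).neighborSet u).ncard < (G.neighborSet u).ncard := by
  refine Set.ncard_lt_ncard ⟨fun _ h => h.1, fun h => ht ?_⟩ (Set.toFinite _)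
  exact (h (show t ∈ G.neighborSet u from hut)).2.2

theorem ncard_neighborSet_restrictEdges_of_notMem {T : Set V} {u : V} (hu : u ∉ T) :
    ((restrictEdges G T).neighborSet u).ncard = 0 := by
  rw [Set.ncard_eq_zero (Set.toFinite _)]
  exact Set.eq_empty_of_forall_notMem fun _ h => hu h.2.1

/-- A `k`-edge-colouring extends to a further vertex `t` if all vertices have degree at most `k`
and at most one neighbour of `t` has degree `k`. -/
theorem exists_isProperEdgeColoring_insert {k : ℕ} (hk : ∀ v, (G.neighborSet v).ncard ≤ k)
    (T : Set V) (t : V) (ht : t ∉ T) (u₀ : V)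
    (hu₀ : ∀ u ∈ T, G.Adj t u → (G.neighborSet u).ncard = k → u = u₀) {f : V → V → ℕ}
    (hf : IsProperEdgeColoring (restrictEdges G T) (Finset.range k) f) :
    ∃ f', IsProperEdgeColoring (restrictEdges G (insert t T)) (Finset.range k) f' := by
  classical
  let N : Finset V := (Set.toFinite {u | u ∈ T ∧ G.Adj t u}).toFinset
  have hmemN : ∀ u, u ∈ N ↔ u ∈ T ∧ G.Adj t u := fun u => Set.Finite.mem_toFinset _
  have hNk : N.card ≤ (Finset.range k).card := by
    rw [Finset.card_range, ← Set.ncard_eq_toFinset_card _ (Set.toFinite _)]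
    exact (Set.ncard_le_ncard (fun u hu => hu.2) (Set.toFinite _)).trans (hk t)
  choose Y hYS hY hYc using exists_missing_colors (restrictEdges G T) f (Finset.range k)
  obtain ⟨f', g, hf', hg, hgm⟩ := exists_recoloring_of_card_missing (Finset.range k)
    (restrictEdges G T) f N u₀ Y hf hNk (fun u _ => hYS u) (fun u _ => hY u) (by
      intro u hu
      rw [hmemN] at hu
      have h1 := hYc u
      have h2 := ncard_neighborSet_restrictEdges_lt (T := T) hu.2.symm ht
      have h3 := hk u
      have h4 := hu₀ u hu.1 hu.2
      rw [Finset.card_range] at h1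
      split_ifs with h
      · omega
      · have h5 : (G.neighborSet u).ncard ≠ k := fun e => h (h4 e)
        omega)
  have hT : ∀ {a}, a ∈ insert t T → a ≠ t → a ∈ T := fun h h' => h.resolve_left h'
  refine ⟨fun a b => if a = t then g b else if b = t then g a else f' a b, ?_, ?_, ?_⟩
  · intro a b
    by_cases ha : a = t
    · by_cases hb : b = t
      · rw [ha, hb]
      · simp [ha, hb]
    · by_cases hb : b = t
      · simp [ha, hb]
      · simp [ha, hb, hf'.symm a b]
  · rintro a b ⟨hab, ha, hb⟩
    split_ifs with h1 h2
    · subst h1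
      exact (hgm b ((hmemN b).2 ⟨hT hb hab.ne', hab⟩)).1
    · subst h2
      exact (hgm a ((hmemN a).2 ⟨hT ha h1, hab.symm⟩)).1
    · exact hf'.mem a b ⟨hab, hT ha h1, hT hb h2⟩
  · rintro a b c ⟨hab, ha, hb⟩ ⟨hac, -, hc⟩ h
    split_ifs at h with h1 h2 h3 h3
    · subst h1
      exact hg (Finset.mem_coe.2 ((hmemN b).2 ⟨hT hb hab.ne', hab⟩))
        (Finset.mem_coe.2 ((hmemN c).2 ⟨hT hc hac.ne', hac⟩)) h
    · exact h2.trans h3.symm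
    · subst h2
      exact absurd h.symm
        ((hgm a ((hmemN a).2 ⟨hT ha h1, hab.symm⟩)).2 c ⟨hac, hT ha h1, hT hc h3⟩)
    · subst h3
      exact absurd h
        ((hgm a ((hmemN a).2 ⟨hT ha h1, hac.symm⟩)).2 b ⟨hab, hT ha h1, hT hb h2⟩)
    · exact hf'.inj a b c ⟨hab, hT ha h1, hT hb h2⟩ ⟨hac, hT ha h1, hT hc h3⟩ h

/-- A graph of maximum degree at most `k` with at most two vertices of degree `k` is
`k`-edge-colourable: add the vertices one at a time, one of the two at the end. This includes
Vizing's theorem, as the case without vertices of degree `k`. -/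
theorem exists_isProperEdgeColoring {k : ℕ} (hk : ∀ v, (G.neighborSet v).ncard ≤ k) (a b : V)
    (hab : ∀ v, (G.neighborSet v).ncard = k → v = a ∨ v = b) :
    ∃ f, IsProperEdgeColoring G (Finset.range k) f := by
  classical
  have := Fintype.ofFinite V
  have key : ∀ T : Finset V, a ∉ T →
      ∃ f, IsProperEdgeColoring (restrictEdges G (T : Set V)) (Finset.range k) f := by
    intro T
    induction T using Finset.induction_on with
    | empty =>
      intro _
      refine ⟨fun _ _ => 0, fun _ _ => rfl, fun x y h => ?_, fun x y z h => ?_⟩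
      · simpa using h.2.1
      · simpa using h.2.1
    | insert t T ht ih =>
      intro ha
      rw [Finset.mem_insert, not_or] at ha
      obtain ⟨f, hf⟩ := ih ha.2
      rw [Finset.coe_insert]
      refine exists_isProperEdgeColoring_insert hk T t (by simpa using ht) b ?_ hf
      rintro u hu - hdu
      refine (hab u hdu).resolve_left ?_
      rintro rfl
      exact ha.2 (by simpa using hu)
  obtain ⟨f, hf⟩ := key (Finset.univ.erase a) (by simp)
  obtain ⟨f', hf'⟩ := exists_isProperEdgeColoring_insert hk _ a (by simp) b (by
    rintro u hu - hdu
    exact (hab u hdu).resolve_left (by simpa using hu)) hf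
  refine ⟨f', hf'.symm, fun x y h => hf'.mem x y ⟨h, ?_, ?_⟩,
    fun x y z h h' => hf'.inj x y z ⟨h, ?_, ?_⟩ ⟨h', ?_, ?_⟩⟩ <;>
  simp

end VertexColoring

/-! ### Colourings that are proper at all vertices but one -/

/-- The edge-colouring `f` of `G` with colours below `k` is proper at each vertex other than
`w`. -/
structure IsProperExceptAt {V : Type*} (G : SimpleGraph V) (k : ℕ) (w : V) (f : V → V → ℕ) :
    Prop where
  symm : ∀ a b, f a b = f b a
  lt : ∀ a b, G.Adj a b → f a b < k
  inj : ∀ a b c, a ≠ w → G.Adj a b → G.Adj a c → f a b = f a c → b = c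

/-- Colour `G - w` properly, and give each edge at `w` a colour missing at its other end. -/
theorem exists_isProperExceptAt {V : Type*} [Finite V] {G : SimpleGraph V} {k : ℕ} (hk : 1 ≤ k)
    (w : V) (hdeg : ∀ t, t ≠ w → (G.neighborSet t).ncard ≤ k) (a b : V)
    (hab : ∀ t, t ≠ w → (G.neighborSet t).ncard = k → ¬ G.Adj w t → t = a ∨ t = b) :
    ∃ f, IsProperExceptAt G k w f := by
  classical
  have hw : w ∉ ({w}ᶜ : Set V) := by simp
  obtain ⟨f, hf⟩ := exists_isProperEdgeColoring (G := restrictEdges G {w}ᶜ) (k := k) (by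
      intro v
      by_cases hv : v = w
      · rw [hv, ncard_neighborSet_restrictEdges_of_notMem hw]
        exact Nat.zero_le k
      · exact (ncard_neighborSet_restrictEdges_le _ v).trans (hdeg v hv)) a b (by
    intro v hvk
    by_cases hv : v = w
    · rw [hv, ncard_neighborSet_restrictEdges_of_notMem hw] at hvk
      omega
    · have h1 := ncard_neighborSet_restrictEdges_le (G := G) {w}ᶜ v
      have h2 := hdeg v hv
      refine hab v hv (by omega) fun hadj => ?_
      have h3 := ncard_neighborSet_restrictEdges_lt hadj.symm hw
      omega)
  have hex : ∀ t, ∃ i, G.Adj w t → i < k ∧ IsMissingColor (restrictEdges G {w}ᶜ) f t i := by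
    intro t
    by_cases ht : G.Adj w t
    · obtain ⟨Y, hYS, hY, hYc⟩ := exists_missing_colors (restrictEdges G {w}ᶜ) f (Finset.range k) t
      have h1 := ncard_neighborSet_restrictEdges_lt ht.symm hw
      have h2 := hdeg t ht.ne'
      rw [Finset.card_range] at hYc
      obtain ⟨i, hi⟩ : Y.Nonempty := Finset.card_pos.1 (by omega)
      exact ⟨i, fun _ => ⟨Finset.mem_range.1 (hYS hi), hY i hi⟩⟩
    · exact ⟨0, fun h => absurd h ht⟩
  choose m hm using hex
  refine ⟨fun x y => if x = w then m y else if y = w then m x else f x y, ?_, ?_, ?_⟩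
  · intro x y
    by_cases hx : x = w
    · by_cases hy : y = w
      · rw [hx, hy]
      · simp [hx, hy]
    · by_cases hy : y = w
      · simp [hx, hy]
      · simp [hx, hy, hf.symm x y]
  · intro x y h
    split_ifs with h1 h2
    · exact (hm y (h1 ▸ h)).1
    · exact (hm x (h2 ▸ h.symm)).1
    · exact Finset.mem_range.1 (hf.mem x y ⟨h, h1, h2⟩)
  · intro x y z hx hxy hxz h
    rw [if_neg hx, if_neg hx] at h
    split_ifs at h with h1 h2 h2
    · exact h1.trans h2.symm
    · exact absurd h.symm ((hm x (h1 ▸ hxy.symm)).2 z ⟨hxz, hx, h2⟩)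
    · exact absurd h ((hm x (h2 ▸ hxz.symm)).2 y ⟨hxy, hx, h1⟩)
    · exact hf.inj x y z ⟨hxy, hx, h1⟩ ⟨hxz, hx, h2⟩ h

/-! ### Bounds for the rainbow disconnection number -/

/-- An edge-colouring with `k` colours bounds `rd G` by `k` if any two vertices are separated by
a set `A` of vertices whose boundary edges have distinct colours. -/
theorem rd_le_of_boundary {V : Type*} {G : SimpleGraph V} {k : ℕ} {f : V → V → ℕ}
    (hf : ∀ a b, f a b = f b a) (hk : ∀ a b, G.Adj a b → f a b < k)
    (h : ∀ u v, u ≠ v → ∃ A : Set V, (u ∈ A ∧ v ∉ A ∨ v ∈ A ∧ u ∉ A) ∧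
      ∀ a ∈ A, ∀ b ∉ A, ∀ a' ∈ A, ∀ b' ∉ A, G.Adj a b → G.Adj a' b' → f a b = f a' b' →
        a = a' ∧ b = b') : rd G ≤ k := by
  have hlt : ∀ e : Sym2 V, e ∈ G.edgeSet → Sym2.lift ⟨f, hf⟩ e < k := by
    intro e
    induction e using Sym2.ind with
    | _ a b => exact hk a b
  refine Nat.sInf_le ⟨fun e => ⟨Sym2.lift ⟨f, hf⟩ e.1, hlt e.1 e.2⟩, fun u v huv => ?_⟩
  obtain ⟨A, hA, hr⟩ := h u v huv
  let R : Set G.edgeSet := {e | ∃ a ∈ A, ∃ b ∉ A, e.1 = s(a, b)}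
  have hsep : ∀ x y, x ∈ A → y ∉ A → ¬ (G.deleteEdges (Subtype.val '' R)).Reachable x y := by
    rintro x y hx hy ⟨p⟩
    obtain ⟨d, -, hd1, hd2⟩ := p.exists_boundary_dart A hx hy
    have hadj := d.adj
    rw [SimpleGraph.deleteEdges_adj] at hadj
    exact hadj.2 ⟨⟨s(d.fst, d.snd), hadj.1⟩, ⟨d.fst, hd1, d.snd, hd2, rfl⟩, rfl⟩
  have hsep' : ¬ (G.deleteEdges (Subtype.val '' R)).Reachable u v := by
    rcases hA with hA | hA
    · exact hsep u v hA.1 hA.2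
    · exact fun hreach => hsep v u hA.1 hA.2 hreach.symm
  refine ⟨R, fun hc => hsep' (hc.preconnected u v), ?_, hsep'⟩
  rintro ⟨e, he⟩ ⟨a, ha, b, hb, hab⟩ ⟨e', he'⟩ ⟨a', ha', b', hb', hab'⟩ hc
  dsimp only at hab hab'
  subst hab hab'
  obtain ⟨rfl, rfl⟩ := hr a ha b hb a' ha' b' hb' he he' (congrArg Fin.val hc)
  rfl

/-- Pendant vertices do not affect the bound: a pendant vertex is cut off by its only edge, and
another vertex is cut off, along with the pendant vertices attached to it, by its other edges. The
one vertex at which the colouring may fail to be proper need not be cut off. -/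
theorem rd_le_of_isProperExceptAt {V : Type*} {G : SimpleGraph V} {k : ℕ} (hk : 1 ≤ k) (P : Set V)
    (hP : ∀ p ∈ P, (G.neighborSet p).Subsingleton)
    {w : V} {f : V → V → ℕ} (hf : IsProperExceptAt (restrictEdges G Pᶜ) k w f) : rd G ≤ k := by
  classical
  have hsingle : ∀ p ∈ P, ∀ b b', G.Adj p b → G.Adj p b' → b = b' :=
    fun p hp b b' hb hb' => hP p hp hb hb'
  have hstar : ∀ t, t ∉ P → t ≠ w → ∀ a ∈ {t} ∪ {p | p ∈ P ∧ G.Adj p t},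
      ∀ b ∉ {t} ∪ {p | p ∈ P ∧ G.Adj p t}, G.Adj a b →
        a = t ∧ (restrictEdges G Pᶜ).Adj t b := by
    rintro t ht - a (rfl | ha) b hb hab
    · exact ⟨rfl, hab, ht, fun hbP => hb (Or.inr ⟨hbP, hab.symm⟩)⟩
    · exact absurd (Or.inl (hsingle a ha.1 b t hab ha.2)) hb
  refine rd_le_of_boundary (f := fun a b => if a ∈ P ∨ b ∈ P then 0 else f a b) ?_ ?_ ?_
  · intro a b
    simp only [or_comm, hf.symm a b]
  · intro a b hab
    split_ifs with h
    · exact hk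
    · rw [not_or] at h
      exact hf.lt a b ⟨hab, h⟩
  · intro u v huv
    have hpend : ∀ x ∈ P, ∀ a ∈ ({x} : Set V), ∀ b ∉ ({x} : Set V), ∀ a' ∈ ({x} : Set V),
        ∀ b' ∉ ({x} : Set V), G.Adj a b → G.Adj a' b' →
        (if a ∈ P ∨ b ∈ P then 0 else f a b) = (if a' ∈ P ∨ b' ∈ P then 0 else f a' b') →
        a = a' ∧ b = b' := by
      rintro x hx a rfl b - a' rfl b' - hab hab' -
      exact ⟨rfl, hsingle _ hx b b' hab hab'⟩
    by_cases hu : u ∈ P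
    · exact ⟨{u}, Or.inl ⟨rfl, huv.symm⟩, hpend u hu⟩
    by_cases hv : v ∈ P
    · exact ⟨{v}, Or.inr ⟨rfl, huv⟩, hpend v hv⟩
    have key : ∀ t, t ∉ P → t ≠ w → ∀ a ∈ {t} ∪ {p | p ∈ P ∧ G.Adj p t},
        ∀ b ∉ {t} ∪ {p | p ∈ P ∧ G.Adj p t}, ∀ a' ∈ {t} ∪ {p | p ∈ P ∧ G.Adj p t},
        ∀ b' ∉ {t} ∪ {p | p ∈ P ∧ G.Adj p t}, G.Adj a b → G.Adj a' b' →
        (if a ∈ P ∨ b ∈ P then 0 else f a b) = (if a' ∈ P ∨ b' ∈ P then 0 else f a' b') →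
        a = a' ∧ b = b' := by
      intro t ht htw a ha b hb a' ha' b' hb' hab hab' h
      obtain ⟨rfl, h1⟩ := hstar t ht htw a ha b hb hab
      obtain ⟨rfl, h2⟩ := hstar a ht htw a' ha' b' hb' hab'
      rw [if_neg (not_or.2 h1.2), if_neg (not_or.2 h2.2)] at h
      exact ⟨rfl, hf.inj _ b b' htw h1 h2 h⟩
    by_cases huw : u = w
    · refine ⟨_, Or.inr ⟨Or.inl rfl, ?_⟩, key v hv fun h => huv (huw.trans h.symm)⟩
      rintro (h | h)
      · exact huv h
      · exact hu h.1
    · refine ⟨_, Or.inl ⟨Or.inl rfl, ?_⟩, key u hu huw⟩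
      rintro (h | h)
      · exact huv h.symm
      · exact hv h.1

theorem exists_subset_pair_of_ncard_le_two {V : Type*} [Finite V] {Q : Set V} (v : V)
    (hQ : Q.ncard ≤ 2) : ∃ a b, ∀ t ∈ Q, t = a ∨ t = b := by
  obtain h | h | h : Q.ncard = 0 ∨ Q.ncard = 1 ∨ Q.ncard = 2 := by omega
  · rw [Set.ncard_eq_zero (Set.toFinite _)] at h
    exact ⟨v, v, by simp [h]⟩
  · obtain ⟨a, rfl⟩ := Set.ncard_eq_one.1 h
    exact ⟨a, a, by simp⟩
  · obtain ⟨a, b, -, rfl⟩ := Set.ncard_eq_two.1 h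
    exact ⟨a, b, by simp⟩

section UpperBounds

variable {V : Type*} [Finite V] {G : SimpleGraph V} {k : ℕ}

/-- After removal of a set `P` of pendant vertices, all degrees are at most `k` except possibly
that of `w`, and `w` has at most two non-neighbours. -/
theorem rd_le_of_center (hk : 1 ≤ k) (P : Set V) (hP : ∀ p ∈ P, (G.neighborSet p).Subsingleton)
    (w : V) (hw : w ∉ P)
    (hdeg : ∀ t, t ∉ P → t ≠ w → ((restrictEdges G Pᶜ).neighborSet t).ncard ≤ k)
    (hwdeg : Pᶜ.ncard ≤ ((restrictEdges G Pᶜ).neighborSet w).ncard + 3) : rd G ≤ k := by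
  let Q : Set V := {t | t ∉ P ∧ t ≠ w ∧ ¬ G.Adj w t}
  have hQ : Q.ncard ≤ 2 := by
    have hsub : insert w ((restrictEdges G Pᶜ).neighborSet w) ∪ Q ⊆ Pᶜ := by
      rintro t ((rfl | h) | h)
      · exact hw
      · exact h.2.2
      · exact h.1
    have h1 := Set.ncard_le_ncard hsub (Set.toFinite _)
    rw [Set.ncard_union_eq ?_ (Set.toFinite _) (Set.toFinite _), Set.ncard_insert_of_notMem ?_
      (Set.toFinite _)] at h1
    · omega
    · exact fun h => G.loopless.irrefl w h.1
    · rw [Set.disjoint_left]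
      rintro t (rfl | h) h'
      · exact h'.2.1 rfl
      · exact h'.2.2 h.1
  obtain ⟨a, b, hab⟩ := exists_subset_pair_of_ncard_le_two w hQ
  have hzero : ∀ t ∈ P, ((restrictEdges G Pᶜ).neighborSet t).ncard = 0 := fun t ht =>
    ncard_neighborSet_restrictEdges_of_notMem (by simpa using ht)
  obtain ⟨f, hf⟩ := exists_isProperExceptAt (G := restrictEdges G Pᶜ) hk w (by
    intro t htw
    by_cases ht : t ∈ P
    · rw [hzero t ht]
      exact Nat.zero_le k
    · exact hdeg t ht htw) a b (by
    intro t htw htk hadj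
    have ht : t ∉ P := fun ht => by
      rw [hzero t ht] at htk
      omega
    exact hab t ⟨ht, htw, fun h => hadj ⟨h, hw, ht⟩⟩)
  exact rd_le_of_isProperExceptAt hk P hP hf

/-- A graph on at most `k + 3` vertices, not counting pendant vertices, has `rd G ≤ k` if all
degrees are at most `k` after the removal of the pendant vertices. -/
theorem rd_le_of_ncard_neighborSet_le [Nonempty V] (hk : 1 ≤ k) (P : Set V)
    (hP : ∀ p ∈ P, (G.neighborSet p).Subsingleton)
    (hdeg : ∀ t, t ∉ P → ((restrictEdges G Pᶜ).neighborSet t).ncard ≤ k)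
    (hcard : Pᶜ.ncard ≤ k + 3) : rd G ≤ k := by
  have hzero : ∀ t ∈ P, ((restrictEdges G Pᶜ).neighborSet t).ncard = 0 := fun t ht =>
    ncard_neighborSet_restrictEdges_of_notMem (by simpa using ht)
  by_cases h : ∃ w, w ∉ P ∧ ((restrictEdges G Pᶜ).neighborSet w).ncard = k
  · obtain ⟨w, hw, hwk⟩ := h
    exact rd_le_of_center hk P hP w hw (fun t ht _ => hdeg t ht) (by omega)
  · push Not at h
    obtain ⟨w⟩ := ‹Nonempty V›
    obtain ⟨f, hf⟩ := exists_isProperExceptAt (G := restrictEdges G Pᶜ) hk w (by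
      intro t _
      by_cases ht : t ∈ P
      · rw [hzero t ht]
        exact Nat.zero_le k
      · exact hdeg t ht) w w (by
      intro t _ htk
      by_cases ht : t ∈ P
      · rw [hzero t ht] at htk
        omega
      · exact absurd htk (h t ht))
    exact rd_le_of_isProperExceptAt hk P hP hf

end UpperBounds

/-- If every edge set separating `u` and `v` has at least `k` edges, then `k` colours are
needed. -/
theorem le_rd_of_separating {V : Type*} [Finite V] {G : SimpleGraph V} {k : ℕ} {u v : V}
    (huv : u ≠ v) (h : ∀ R : Set (Sym2 V), ¬ (G.deleteEdges R).Reachable u v → k ≤ R.ncard) :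
    k ≤ rd G := by
  obtain ⟨c, hc⟩ : rd G ∈ {k : ℕ | ∃ c : G.edgeSet → Fin k, IsRainbowDisconnection G c} :=
    Nat.sInf_mem (exists_isRainbowDisconnection G)
  obtain ⟨R, hR⟩ := hc u v huv
  have h1 := h _ hR.separates
  rw [Set.ncard_image_of_injective _ Subtype.val_injective, ← hR.rainbow.ncard_image] at h1
  have h2 := Set.ncard_le_ncard (Set.subset_univ (c '' R)) (Set.toFinite _)
  rw [Set.ncard_univ, Nat.card_eq_fintype_card, Fintype.card_fin] at h2
  omega

section LowerBounds

variable {V : Type*} [Finite V] {G : SimpleGraph V} {u v : V} {C : Set V} {R : Set (Sym2 V)}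

/-- A set of edges separating two adjacent vertices `u` and `v` contains `uv` and, for each common
neighbour `t`, one of `ut` and `vt`. -/
theorem exists_separating_subset (huv : G.Adj u v) (hC : ∀ t ∈ C, G.Adj u t ∧ G.Adj v t)
    (hR : ¬ (G.deleteEdges R).Reachable u v) :
    ∃ R' ⊆ R, R'.ncard = C.ncard + 1 ∧
      ∀ e ∈ R', e = s(u, v) ∨ ∃ t ∈ C, e = s(u, t) ∨ e = s(v, t) := by
  classical
  let g : V → Sym2 V := fun t => if s(u, t) ∈ R then s(u, t) else s(v, t)
  have hgR : ∀ t ∈ C, g t ∈ R := by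
    intro t ht
    simp only [g]
    split_ifs with h
    · exact h
    · by_contra h'
      refine hR (SimpleGraph.Reachable.trans (v := t) ?_ ?_) <;> refine SimpleGraph.Adj.reachable ?_
      · exact SimpleGraph.deleteEdges_adj.2 ⟨(hC t ht).1, h⟩
      · rw [SimpleGraph.adj_comm]
        exact SimpleGraph.deleteEdges_adj.2 ⟨(hC t ht).2, h'⟩
  have hg : ∀ t, g t = s(u, t) ∨ g t = s(v, t) := by
    intro t
    simp only [g]
    split_ifs
    · exact Or.inl rfl
    · exact Or.inr rfl
  have hne : ∀ t ∈ C, u ≠ t ∧ v ≠ t := fun t ht => ⟨(hC t ht).1.ne, (hC t ht).2.ne⟩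
  have hinj : Set.InjOn g C := by
    intro t ht t' ht' h
    have h1 := hne t ht
    have h2 := hne t' ht'
    have hmem : t ∈ g t' := by
      rw [← h]
      rcases hg t with h | h <;> rw [h] <;> simp
    rcases hg t' with h' | h' <;> rw [h', Sym2.mem_iff] at hmem
    · exact hmem.resolve_left h1.1.symm
    · exact hmem.resolve_left h1.2.symm
  refine ⟨insert s(u, v) (g '' C), ?_, ?_, ?_⟩
  · rintro e (rfl | ⟨t, ht, rfl⟩)
    · by_contra h
      exact hR (SimpleGraph.Adj.reachable (SimpleGraph.deleteEdges_adj.2 ⟨huv, h⟩))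
    · exact hgR t ht
  · rw [Set.ncard_insert_of_notMem ?_ (Set.toFinite _), hinj.ncard_image]
    rintro ⟨t, ht, h⟩
    have hmem : t ∈ g t := by
      rcases hg t with h | h <;> rw [h] <;> simp
    rw [h, Sym2.mem_iff] at hmem
    exact hmem.elim (hne t ht).1.symm (hne t ht).2.symm
  · rintro e (rfl | ⟨t, ht, rfl⟩)
    · exact Or.inl rfl
    · exact Or.inr ⟨t, ht, hg t⟩

theorem le_rd_of_common_neighbors (huv : G.Adj u v) (hC : ∀ t ∈ C, G.Adj u t ∧ G.Adj v t) :
    C.ncard + 1 ≤ rd G := by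
  refine le_rd_of_separating huv.ne fun R hR => ?_
  obtain ⟨R', hR', hcard, -⟩ := exists_separating_subset huv hC hR
  rw [← hcard]
  exact Set.ncard_le_ncard hR' (Set.toFinite _)

/-- A path from `u` to `v` through other vertices than those of `C` gives one more edge. -/
theorem le_rd_of_common_neighbors_of_path (huv : G.Adj u v)
    (hC : ∀ t ∈ C, G.Adj u t ∧ G.Adj v t) {x y : V} (hux : G.Adj u x) (hvy : G.Adj v y)
    (hx : x ∈ ({u, v} : Set V)ᶜ) (hy : y ∈ ({u, v} : Set V)ᶜ) (hxC : x ∉ C) (hyC : y ∉ C)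
    (hxy : (G.induce ({u, v} : Set V)ᶜ).Reachable ⟨x, hx⟩ ⟨y, hy⟩) :
    C.ncard + 2 ≤ rd G := by
  refine le_rd_of_separating huv.ne fun R hR => ?_
  obtain ⟨R', hR', hcard, hform⟩ := exists_separating_subset huv hC hR
  suffices h : ∃ e ∈ R, e ∉ R' by
    obtain ⟨e, heR, heR'⟩ := h
    rw [show C.ncard + 2 = (insert e R').ncard by
      rw [Set.ncard_insert_of_notMem heR' (Set.toFinite _), hcard]]
    exact Set.ncard_le_ncard (Set.insert_subset heR hR') (Set.toFinite _)
  have hx' : x ≠ u ∧ x ≠ v := by simpa [not_or] using hx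
  have hy' : y ≠ u ∧ y ≠ v := by simpa [not_or] using hy
  have hmem : ∀ e ∈ R', ∀ a b, e = s(a, b) → a = u ∨ a = v ∨ a ∈ C := by
    rintro e he a b rfl
    have ha : a ∈ s(a, b) := Sym2.mem_mk_left a b
    rcases hform _ he with h | ⟨t, ht, h | h⟩ <;> rw [h, Sym2.mem_iff] at ha
    · exact ha.imp_right Or.inl
    · exact ha.imp_right fun h => Or.inr (by rwa [h])
    · exact Or.inr (ha.imp_right fun h => by rwa [h])
  have hmeet : ∀ e ∈ R', ∀ a b, e = s(a, b) → a = u ∨ a = v ∨ b = u ∨ b = v := by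
    rintro e he a b rfl
    rcases hform _ he with h | ⟨t, ht, h | h⟩ <;> rw [Sym2.eq_iff] at h <;> tauto
  let A : Set V := {t | (G.deleteEdges R).Reachable u t}
  by_cases hxA : x ∈ A
  · by_cases hyA : y ∈ A
    · refine ⟨s(y, v), ?_, fun h => ?_⟩
      · by_contra h
        exact hR (SimpleGraph.Reachable.trans hyA (SimpleGraph.Adj.reachable
          (SimpleGraph.deleteEdges_adj.2 ⟨hvy.symm, h⟩)))
      · rcases hmem _ h y v rfl with h | h | h
        exacts [hy'.1 h, hy'.2 h, hyC h]
    · obtain ⟨p⟩ := hxy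
      obtain ⟨d, -, hd1, hd2⟩ := p.exists_boundary_dart (Subtype.val ⁻¹' A) hxA hyA
      have hadj : G.Adj d.fst.1 d.snd.1 := d.adj
      refine ⟨s(d.fst.1, d.snd.1), ?_, fun h => ?_⟩
      · by_contra h
        exact hd2 (SimpleGraph.Reachable.trans hd1 (SimpleGraph.Adj.reachable
          (SimpleGraph.deleteEdges_adj.2 ⟨hadj, h⟩)))
      · have h1 := d.fst.2
        have h2 := d.snd.2
        simp only [Set.mem_compl_iff, Set.mem_insert_iff, Set.mem_singleton_iff, not_or] at h1 h2
        have := hmeet _ h _ _ rfl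
        tauto
  · refine ⟨s(x, u), ?_, fun h => ?_⟩
    · by_contra h
      rw [Sym2.eq_swap] at h
      exact hxA (SimpleGraph.Adj.reachable (SimpleGraph.deleteEdges_adj.2 ⟨hux, h⟩))
    · rcases hmem _ h x u rfl with h | h | h
      exacts [hx'.1 h, hx'.2 h, hxC h]

end LowerBounds

/-! ### Two adjacent vertices with distant non-neighbours -/

/-- Let `u` be adjacent to all vertices but `y`, and `v` to all vertices but `x`, where `x` and `y`
lie in different components of `G - u - v`, and let all other degrees be at most `n - 3`. Then
`n - 3` colours suffice.

Let `A` be a union of components of `G - u - v` that contains `x` but not `y`. The boundary of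
`A ∪ {u}` has `n - 3` edges: `uv`, the edges from `v` to `A`, and the edges from `u` to the other
vertices. To give them distinct colours, move the edges `vt` with `t ∈ A` to `ut`, and drop the
other edges at `v` as well as the edges from `u` to `A`. The resulting graph has maximum degree at
most `n - 4`, so it is `(n - 3)`-edge-colourable; the dropped edges get missing colours. -/
theorem rd_le_of_disconnected {V : Type*} [Finite V] {G : SimpleGraph V} {k : ℕ}
    (hcard : Nat.card V = k + 3) {u v x y : V} (huv : u ≠ v)
    (hu : ∀ t, G.Adj u t ↔ t ≠ u ∧ t ≠ y) (hv : ∀ t, G.Adj v t ↔ t ≠ v ∧ t ≠ x)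
    (hxu : x ≠ u) (hxv : x ≠ v) (hyu : y ≠ u) (hyv : y ≠ v) (A : Set V) (huA : u ∉ A)
    (hvA : v ∉ A) (hxA : x ∈ A) (hyA : y ∉ A)
    (hA : ∀ a ∈ A, ∀ b, G.Adj a b → b ∈ A ∨ b = u ∨ b = v)
    (hdeg : ∀ t, t ≠ u → t ≠ v → (G.neighborSet t).ncard ≤ k) : rd G ≤ k := by
  classical
  have hxy : x ≠ y := fun h => hyA (h ▸ hxA)
  let M : SimpleGraph V :=
    { Adj := fun a b => (G.Adj a b ∧ a ≠ u ∧ a ≠ v ∧ b ≠ u ∧ b ≠ v) ∨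
        (a = u ∧ b ≠ u ∧ b ≠ v ∧ b ≠ x ∧ b ≠ y) ∨ (b = u ∧ a ≠ u ∧ a ≠ v ∧ a ≠ x ∧ a ≠ y)
      symm := ⟨by
        rintro a b (⟨h, h1, h2, h3, h4⟩ | h | h)
        · exact Or.inl ⟨h.symm, h3, h4, h1, h2⟩
        · exact Or.inr (Or.inr h)
        · exact Or.inr (Or.inl h)⟩
      loopless := ⟨by
        rintro a (⟨h, -⟩ | ⟨h, h', -⟩ | ⟨h, h', -⟩)
        · exact G.loopless.irrefl a h
        · exact h' h
        · exact h' h⟩ }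
  have hMu : ∀ t, M.Adj u t ↔ t ≠ u ∧ t ≠ v ∧ t ≠ x ∧ t ≠ y := by
    intro t
    refine ⟨?_, fun h => Or.inr (Or.inl ⟨rfl, h⟩)⟩
    rintro (h | h | h)
    · exact absurd rfl h.2.1
    · exact h.2
    · exact absurd rfl h.2.1
  have hMadj : ∀ a b, a ≠ u → a ≠ v → b ≠ u → b ≠ v → G.Adj a b → M.Adj a b :=
    fun a b h1 h2 h3 h4 h => Or.inl ⟨h, h1, h2, h3, h4⟩
  have hMdeg : ∀ t, (M.neighborSet t).ncard < k := by
    intro t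
    by_cases htu : t = u
    · rw [htu]
      have hsub : M.neighborSet u ∪ {u, v, x, y} ⊆ Set.univ := Set.subset_univ _
      have h1 := Set.ncard_le_ncard hsub (Set.toFinite _)
      rw [Set.ncard_union_eq ?_ (Set.toFinite _) (Set.toFinite _), Set.ncard_univ, hcard,
        Set.ncard_insert_of_notMem (by simp [huv, hxu.symm, hyu.symm]) (Set.toFinite _),
        Set.ncard_insert_of_notMem (by simp [hxv.symm, hyv.symm]) (Set.toFinite _),
        Set.ncard_pair hxy] at h1
      · omega
      · rw [Set.disjoint_left]
        intro s hs hs'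
        have := (hMu s).1 hs
        simp only [Set.mem_insert_iff, Set.mem_singleton_iff] at hs'
        tauto
    by_cases htv : t = v
    · have h0 : M.neighborSet t = ∅ := by
        refine Set.eq_empty_of_forall_notMem fun s hs => ?_
        rcases hs with h | h | h
        · exact h.2.2.1 htv
        · exact htu h.1
        · exact h.2.2.1 htv
      have h1 : ({u, v, x, y} : Set V).ncard ≤ Nat.card V := by
        rw [← Set.ncard_univ]
        exact Set.ncard_le_ncard (Set.subset_univ _) (Set.toFinite _)
      rw [hcard, Set.ncard_insert_of_notMem (by simp [huv, hxu.symm, hyu.symm]) (Set.toFinite _),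
        Set.ncard_insert_of_notMem (by simp [hxv.symm, hyv.symm]) (Set.toFinite _),
        Set.ncard_pair hxy] at h1
      rw [h0, Set.ncard_empty]
      omega
    refine lt_of_lt_of_le (Set.ncard_lt_ncard ⟨?_, ?_⟩ (Set.toFinite _)) (hdeg t htu htv)
    · rintro s (h | h | h)
      · exact h.1
      · exact absurd h.1 htu
      · rw [h.1]
        exact ((hu t).2 ⟨htu, h.2.2.2.2⟩).symm
    · intro hsub
      by_cases htx : t = x
      · have h1 : M.Adj t u := hsub ((hu t).2 ⟨htu, htx ▸ hxy⟩).symm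
        exact ((hMu t).1 h1.symm).2.2.1 htx
      · rcases hsub ((hv t).2 ⟨htv, htx⟩).symm with h | h | h
        · exact h.2.2.2.2 rfl
        · exact htu h.1
        · exact huv h.1.symm
  obtain ⟨f, hf⟩ := exists_isProperEdgeColoring (G := M) (fun t => (hMdeg t).le) u u
    (fun t ht => absurd ht (hMdeg t).ne)
  have hex : ∀ t, ∃ i, i < k ∧ IsMissingColor M f t i := by
    intro t
    obtain ⟨Y, hYS, hY, hYc⟩ := exists_missing_colors M f (Finset.range k) t
    have h1 := hMdeg t
    rw [Finset.card_range] at hYc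
    obtain ⟨i, hi⟩ : Y.Nonempty := Finset.card_pos.1 (by omega)
    exact ⟨i, Finset.mem_range.1 (hYS hi), hY i hi⟩
  choose m hmk hm using hex
  let φ : V → ℕ := fun t => if t = v then m u else if t ∈ A then m t else f u t
  let ψ : V → ℕ := fun t => if t = u then m u else if t ∈ A then f u t else m t
  let F : V → V → ℕ := fun a b => if a = u then φ b else if a = v then ψ b else
    if b = u then φ a else if b = v then ψ a else f a b
  have hFsymm : ∀ a b, F a b = F b a := by
    intro a b
    simp only [F]
    by_cases h1 : a = u
    · by_cases h2 : b = u
      · rw [h1, h2]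
      · by_cases h3 : b = v
        · simp [φ, ψ, h1, h3, huv.symm]
        · simp [h1, h2, h3]
    · by_cases h2 : a = v
      · by_cases h3 : b = u
        · simp [φ, ψ, h2, h3, huv.symm]
        · by_cases h4 : b = v
          · rw [h2, h4]
          · simp [h2, h3, h4, huv.symm]
      · by_cases h3 : b = u
        · simp [h1, h2, h3]
        · by_cases h4 : b = v
          · simp [h1, h2, h4, huv.symm]
          · simp [h1, h2, h3, h4, hf.symm a b]
  have hMuA : ∀ t ∈ A, G.Adj v t → M.Adj u t := fun t ht h =>
    (hMu t).2 ⟨fun e => huA (e ▸ ht), fun e => hvA (e ▸ ht), ((hv t).1 h).2, fun e => hyA (e ▸ ht)⟩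
  have hMuB : ∀ t ∉ A, t ≠ v → G.Adj u t → M.Adj u t := fun t ht htv h =>
    (hMu t).2 ⟨((hu t).1 h).1, htv, fun e => ht (e ▸ hxA), ((hu t).1 h).2⟩
  have hφ : ∀ t, G.Adj u t → φ t < k := by
    intro t ht
    simp only [φ]
    split_ifs with h1 h2
    · exact hmk u
    · exact hmk t
    · exact Finset.mem_range.1 (hf.mem u t (hMuB t h2 h1 ht))
  have hψ : ∀ t, G.Adj v t → ψ t < k := by
    intro t ht
    simp only [ψ]
    split_ifs with h1 h2
    · exact hmk u
    · exact Finset.mem_range.1 (hf.mem u t (hMuA t h2 ht))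
    · exact hmk t
  -- At a vertex `p ∉ {u, v}`, one of the edges `pu` and `pv` has the missing colour `m p`, and the
  -- other one has the colour of the edge `pu` of `M`.
  have hstar : ∀ p, p ≠ u → p ≠ v → ∀ s s', (∀ z, z = u ∨ z = v → z = s ∨ z = s') →
      F p s = m p → F p s' = f p u → (G.Adj p s' → M.Adj p u) →
      ∀ b c, G.Adj p b → G.Adj p c → F p b = F p c → b = c := by
    intro p hpu hpv s s' hss hs hs' hadj
    have hcase : ∀ b, G.Adj p b → b = s ∧ F p b = m p ∨ b = s' ∧ F p b = f p u ∧ M.Adj p u ∨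
        b ≠ u ∧ F p b = f p b ∧ M.Adj p b := by
      intro b hb
      by_cases hbs : b = s
      · exact Or.inl ⟨hbs, hbs ▸ hs⟩
      · by_cases hbs' : b = s'
        · exact Or.inr (Or.inl ⟨hbs', hbs' ▸ hs', hadj (hbs' ▸ hb)⟩)
        · have hbu : b ≠ u := fun e => (hss b (Or.inl e)).elim hbs hbs'
          have hbv : b ≠ v := fun e => (hss b (Or.inr e)).elim hbs hbs'
          exact Or.inr (Or.inr ⟨hbu, by simp [F, hpu, hpv, hbu, hbv],
            hMadj p b hpu hpv hbu hbv hb⟩)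
    intro b c hb hc h
    rcases hcase b hb with ⟨h1, h2⟩ | ⟨h1, h2, h3⟩ | ⟨h1, h2, h3⟩ <;>
      rcases hcase c hc with ⟨h1', h2'⟩ | ⟨h1', h2', h3'⟩ | ⟨h1', h2', h3'⟩ <;>
      rw [h2, h2'] at h
    · exact h1.trans h1'.symm
    · exact absurd h.symm (hm p u h3')
    · exact absurd h.symm (hm p c h3')
    · exact absurd h (hm p u h3)
    · exact h1.trans h1'.symm
    · exact absurd (hf.inj p u c h3 h3' h).symm h1'
    · exact absurd h (hm p b h3)
    · exact absurd (hf.inj p b u h3 h3' h) h1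
    · exact hf.inj p b c h3 h3' h
  have hstar' : ∀ p, p ≠ u → p ≠ v → ∀ b c, G.Adj p b → G.Adj p c → F p b = F p c → b = c := by
    intro p hpu hpv
    by_cases hpA : p ∈ A
    · refine hstar p hpu hpv u v (fun z h => h) ?_ ?_ fun h => (hMuA p hpA h.symm).symm
      · simp [F, φ, hpu, hpv, hpA]
      · simp [F, ψ, hpu, hpv, hpA, huv.symm, hf.symm p u]
    · refine hstar p hpu hpv v u (fun z h => h.symm) ?_ ?_ fun h => (hMuB p hpA hpv h.symm).symm
      · simp [F, ψ, hpu, hpv, hpA, huv.symm]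
      · simp [F, φ, hpu, hpv, hpA, hf.symm p u]
  -- The boundary of `A ∪ {u}` consists of `uv` and of one edge for each neighbour of `u` in `M`.
  have hbound : ∀ a ∈ insert u A, ∀ b ∉ insert u A, G.Adj a b →
      (a = u ∧ b = v ∧ F a b = m u) ∨ ∃ t, M.Adj u t ∧ F a b = f u t ∧
        ((t ∈ A ∧ a = t ∧ b = v) ∨ (t ∉ A ∧ a = u ∧ b = t)) := by
    intro a ha b hb hab
    have hbu : b ≠ u := fun e => hb (Or.inl e)
    have hbA : b ∉ A := fun h => hb (Or.inr h)
    rcases ha with rfl | ha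
    · by_cases hbv : b = v
      · exact Or.inl ⟨rfl, hbv, by simp [F, φ, hbv]⟩
      · exact Or.inr ⟨b, hMuB b hbA hbv hab, by simp [F, φ, hbv, hbA], Or.inr ⟨hbA, rfl, rfl⟩⟩
    · have hbv : b = v := ((hA a ha b hab).resolve_left hbA).resolve_left hbu
      have hau : a ≠ u := fun e => huA (e ▸ ha)
      have hav : a ≠ v := fun e => hvA (e ▸ ha)
      subst hbv
      exact Or.inr ⟨a, hMuA a ha hab.symm, by simp [F, ψ, hau, hav, ha, hbu],
        Or.inl ⟨ha, rfl, rfl⟩⟩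
  have hcut : ∀ a ∈ insert u A, ∀ b ∉ insert u A, ∀ a' ∈ insert u A, ∀ b' ∉ insert u A,
      G.Adj a b → G.Adj a' b' → F a b = F a' b' → a = a' ∧ b = b' := by
    intro a ha b hb a' ha' b' hb' hab hab' h
    rcases hbound a ha b hb hab with ⟨h1, h2, h3⟩ | ⟨t, ht, h3, h4⟩ <;>
      rcases hbound a' ha' b' hb' hab' with ⟨h1', h2', h3'⟩ | ⟨t', ht', h3', h4'⟩ <;>
      rw [h3, h3'] at h
    · exact ⟨h1.trans h1'.symm, h2.trans h2'.symm⟩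
    · exact absurd h.symm (hm u t' ht')
    · exact absurd h (hm u t ht)
    · obtain rfl := hf.inj u t t' ht ht' h
      rcases h4 with ⟨h5, rfl, rfl⟩ | ⟨h5, rfl, rfl⟩ <;>
        rcases h4' with ⟨h5', rfl, rfl⟩ | ⟨h5', rfl, rfl⟩
      · exact ⟨rfl, rfl⟩
      · exact absurd h5 h5'
      · exact absurd h5' h5
      · exact ⟨rfl, rfl⟩
  have hsing : ∀ p, p ≠ u → p ≠ v → ∀ a ∈ ({p} : Set V), ∀ b ∉ ({p} : Set V),
      ∀ a' ∈ ({p} : Set V), ∀ b' ∉ ({p} : Set V), G.Adj a b → G.Adj a' b' → F a b = F a' b' →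
      a = a' ∧ b = b' := by
    rintro p hpu hpv a rfl b - a' rfl b' - hab hab' h
    exact ⟨rfl, hstar' _ hpu hpv b b' hab hab' h⟩
  refine rd_le_of_boundary (f := F) hFsymm ?_ ?_
  · intro a b hab
    simp only [F]
    split_ifs with h1 h2 h3 h4
    · exact hφ b (h1 ▸ hab)
    · exact hψ b (h2 ▸ hab)
    · exact hφ a (h3 ▸ hab.symm)
    · exact hψ a (h4 ▸ hab.symm)
    · exact Finset.mem_range.1 (hf.mem a b (hMadj a b h1 h2 h3 h4 hab))
  · intro p q hpq
    by_cases hp : p ≠ u ∧ p ≠ v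
    · exact ⟨{p}, Or.inl ⟨rfl, hpq.symm⟩, hsing p hp.1 hp.2⟩
    by_cases hq : q ≠ u ∧ q ≠ v
    · exact ⟨{q}, Or.inr ⟨rfl, hpq⟩, hsing q hq.1 hq.2⟩
    refine ⟨insert u A, ?_, hcut⟩
    have hvA' : v ∉ insert u A := by
      rintro (h | h)
      · exact huv h.symm
      · exact hvA h
    rw [not_and_or, not_not, not_not] at hp hq
    rcases hp with rfl | rfl <;> rcases hq with rfl | rfl
    · exact absurd rfl hpq
    · exact Or.inl ⟨Or.inl rfl, hvA'⟩
    · exact Or.inr ⟨Or.inl rfl, hvA'⟩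
    · exact absurd rfl hpq

/-! ### Graphs of maximum degree at most `n - 2` -/

theorem ncard_neighborSet_eq_degree {V : Type*} [Fintype V] (G : SimpleGraph V)
    [DecidableRel G.Adj] (v : V) : (G.neighborSet v).ncard = G.degree v := by
  rw [← G.card_neighborSet_eq_degree, Set.ncard_eq_toFinset_card', Set.toFinset_card]

theorem restrictEdges_compl_empty {V : Type*} (G : SimpleGraph V) :
    restrictEdges G (∅ : Set V)ᶜ = G := by
  ext a b
  simp [restrictEdges]

theorem ncard_neighborSet_restrictEdges_lt_ncard {V : Type*} [Finite V] (G : SimpleGraph V)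
    {T : Set V} {t : V} (ht : t ∈ T) : ((restrictEdges G T).neighborSet t).ncard < T.ncard :=
  Set.ncard_lt_ncard ⟨fun _ h => h.2.2, fun h => (restrictEdges G T).loopless.irrefl t (h ht)⟩
    (Set.toFinite _)

/-- `u` and `v` are adjacent, the only non-neighbour of `u` is `y`, the only non-neighbour of `v`
is `x`, and `x` and `y` are equal or joined by a path in `G - u - v`. -/
structure IsLinkedPair {V : Type*} (G : SimpleGraph V) (u v x y : V) : Prop where
  ne : u ≠ v
  adj_left : ∀ t, G.Adj u t ↔ t ≠ u ∧ t ≠ y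
  adj_right : ∀ t, G.Adj v t ↔ t ≠ v ∧ t ≠ x
  reachable : ∃ (hx : x ∈ ({u, v} : Set V)ᶜ) (hy : y ∈ ({u, v} : Set V)ᶜ),
    (G.induce ({u, v} : Set V)ᶜ).Reachable ⟨x, hx⟩ ⟨y, hy⟩

/-- A closed set of vertices containing some vertex of a connected graph contains them all. -/
theorem mem_of_connected {V : Type*} {G : SimpleGraph V} (hG : G.Connected) {A : Set V}
    (hA : ∀ a ∈ A, ∀ b, G.Adj a b → b ∈ A)
    {a : V} (ha : a ∈ A) (b : V) : b ∈ A := by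
  by_contra hb
  obtain ⟨p⟩ := hG.preconnected a b
  obtain ⟨d, -, hd1, hd2⟩ := p.exists_boundary_dart A ha hb
  exact hd2 (hA _ hd1 _ d.adj)

section Degrees

variable {V : Type*} [Fintype V] {G : SimpleGraph V}

theorem exists_unique_nonneighbor [DecidableEq V] [DecidableRel G.Adj] {u : V}
    (hn : 2 ≤ Fintype.card V) (hu : G.degree u = Fintype.card V - 2) :
    ∃ y, y ≠ u ∧ ∀ t, G.Adj u t ↔ t ≠ u ∧ t ≠ y := by
  have h1 : Gᶜ.degree u = 1 := by
    rw [SimpleGraph.degree_compl, hu]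
    omega
  rw [← ncard_neighborSet_eq_degree, Set.ncard_eq_one] at h1
  obtain ⟨y, hy⟩ := h1
  have hy' : ∀ t, (u ≠ t ∧ ¬ G.Adj u t) ↔ t = y := by
    intro t
    rw [← SimpleGraph.compl_adj, ← SimpleGraph.mem_neighborSet, hy, Set.mem_singleton_iff]
  refine ⟨y, ((hy' y).2 rfl).1.symm, fun t => ?_⟩
  have := hy' t
  constructor
  · intro h
    exact ⟨h.ne', fun e => ((this.2 e).2 h)⟩
  · rintro ⟨h1, h2⟩
    by_contra h
    exact h2 (this.1 ⟨h1.symm, h⟩)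

theorem degree_le_of_compl_connected [DecidableEq V] [DecidableRel G.Adj] (hGc : Gᶜ.Connected)
    (hn : 2 ≤ Fintype.card V) (v : V) : G.degree v ≤ Fintype.card V - 2 := by
  have : Nontrivial V := Fintype.one_lt_card_iff_nontrivial.1 hn
  have h1 := hGc.preconnected.degree_pos_of_nontrivial v
  rw [SimpleGraph.degree_compl] at h1
  omega

theorem rd_le_of_degree_le [Nonempty V] [DecidableRel G.Adj] {k : ℕ} (hk : 1 ≤ k)
    (hdeg : ∀ v, G.degree v ≤ k) (hcard : Fintype.card V ≤ k + 3) : rd G ≤ k := by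
  refine rd_le_of_ncard_neighborSet_le hk ∅ (by simp) ?_ ?_
  · intro t _
    rw [restrictEdges_compl_empty, ncard_neighborSet_eq_degree]
    exact hdeg t
  · rw [Set.compl_empty, Set.ncard_univ, Nat.card_eq_fintype_card]
    exact hcard

theorem IsLinkedPair.card_sub_two_le_rd {u v x y : V} (h : IsLinkedPair G u v x y) :
    Fintype.card V - 2 ≤ rd G := by
  obtain ⟨hx, hy, hr⟩ := h.reachable
  have hx' : x ≠ u ∧ x ≠ v := by simpa [not_or] using hx
  have hy' : y ≠ u ∧ y ≠ v := by simpa [not_or] using hy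
  have huv : G.Adj u v := (h.adj_left v).2 ⟨h.ne.symm, hy'.2.symm⟩
  have hC : ∀ t ∈ ({u, v, x, y} : Set V)ᶜ, G.Adj u t ∧ G.Adj v t := by
    intro t ht
    simp only [Set.mem_compl_iff, Set.mem_insert_iff, Set.mem_singleton_iff, not_or] at ht
    exact ⟨(h.adj_left t).2 ⟨ht.1, ht.2.2.2⟩, (h.adj_right t).2 ⟨ht.2.1, ht.2.2.1⟩⟩
  by_cases hxy : x = y
  · have h1 := le_rd_of_common_neighbors huv hC
    rw [Set.ncard_compl, Nat.card_eq_fintype_card, hxy, Set.pair_eq_singleton] at h1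
    have h2 : ({u, v, y} : Set V).ncard ≤ 3 :=
      (Set.ncard_insert_le _ _).trans (Nat.succ_le_succ
        ((Set.ncard_insert_le _ _).trans (by simp)))
    omega
  · have h1 := le_rd_of_common_neighbors_of_path huv hC
      ((h.adj_left x).2 ⟨hx'.1, hxy⟩) ((h.adj_right y).2 ⟨hy'.2, Ne.symm hxy⟩) hx hy
      (by simp) (by simp) hr
    rw [Set.ncard_compl, Nat.card_eq_fintype_card] at h1
    have h2 : ({u, v, x, y} : Set V).ncard ≤ 4 :=
      (Set.ncard_insert_le _ _).trans (Nat.succ_le_succ ((Set.ncard_insert_le _ _).trans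
        (Nat.succ_le_succ ((Set.ncard_insert_le _ _).trans (by simp)))))
    omega

theorem AdjacentCondition.exists_isLinkedPair [DecidableEq V] [DecidableRel G.Adj]
    (hn : 2 ≤ Fintype.card V) (h : AdjacentCondition G) :
    ∃ u v x y, G.degree u = Fintype.card V - 2 ∧ G.degree v = Fintype.card V - 2 ∧
      IsLinkedPair G u v x y := by
  obtain ⟨-, hadj, u, v, huv, hu, hv, h⟩ := h
  have huv' := hadj u v huv hu hv
  obtain ⟨y, hyu, hy⟩ := exists_unique_nonneighbor hn hu
  obtain ⟨x, hxv, hx⟩ := exists_unique_nonneighbor hn hv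
  refine ⟨u, v, x, y, hu, hv, huv, hy, hx, ?_⟩
  rcases h with ⟨z, hz⟩ | ⟨x', y', -, hx', hy', hr⟩
  · have hz' : ¬ G.Adj u z ∧ ¬ G.Adj v z := not_or.1 hz
    have hzu : z ≠ u := fun e => hz'.2 (e ▸ huv'.symm)
    have hzv : z ≠ v := fun e => hz'.1 (e ▸ huv')
    have h1 : z = y := by
      by_contra e
      exact hz'.1 ((hy z).2 ⟨hzu, e⟩)
    have h2 : z = x := by
      by_contra e
      exact hz'.2 ((hx z).2 ⟨hzv, e⟩)
    subst h1 h2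
    have hmem : z ∈ ({u, v} : Set V)ᶜ := by simp [hzu, hzv]
    exact ⟨hmem, hmem, SimpleGraph.Reachable.refl _⟩
  · have h1 : x' = x := by
      by_contra e
      exact hx'.2 (Or.inr ((hx x').2 ⟨fun e' => hx'.2 (Or.inl e'), e⟩))
    have h2 : y' = y := by
      by_contra e
      exact hy'.2 (Or.inr ((hy y').2 ⟨fun e' => hy'.2 (Or.inl e'), e⟩))
    subst h1 h2
    exact hr

/-- A graph of maximum degree at most `n - 2` satisfying neither condition has
`rd G ≤ n - 3`. -/
theorem rd_le_or_condition [DecidableEq V] [DecidableRel G.Adj] (hn : 4 ≤ Fintype.card V)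
    (hdeg : ∀ v, G.degree v ≤ Fintype.card V - 2) :
    rd G ≤ Fintype.card V - 3 ∨ NonadjacentCondition G ∨ AdjacentCondition G := by
  have : Nonempty V := Fintype.card_pos_iff.1 (by omega)
  by_cases htwo : ∃ u v, u ≠ v ∧ G.degree u = Fintype.card V - 2 ∧
      G.degree v = Fintype.card V - 2
  swap
  · left
    push Not at htwo
    by_cases hone : ∃ w, G.degree w = Fintype.card V - 2
    · obtain ⟨w, hw⟩ := hone
      refine rd_le_of_center (by omega) ∅ (by simp) w (by simp) ?_ ?_
      · intro t _ htw
        rw [restrictEdges_compl_empty, ncard_neighborSet_eq_degree]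
        have h1 := hdeg t
        have h2 := htwo w t htw.symm hw
        omega
      · rw [restrictEdges_compl_empty, ncard_neighborSet_eq_degree, hw, Set.compl_empty,
          Set.ncard_univ, Nat.card_eq_fintype_card]
        omega
    · push Not at hone
      refine rd_le_of_degree_le (by omega) (fun v => ?_) (by omega)
      have h1 := hdeg v
      have h2 := hone v
      omega
  obtain ⟨u, v, huv, hu, hv⟩ := htwo
  have hmax : G.maxDegree = Fintype.card V - 2 :=
    le_antisymm (G.maxDegree_le_of_forall_degree_le _ hdeg) (hu ▸ G.degree_le_maxDegree u)
  by_cases hna : ∃ u v, u ≠ v ∧ G.degree u = Fintype.card V - 2 ∧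
      G.degree v = Fintype.card V - 2 ∧ ¬ G.Adj u v
  · exact Or.inr (Or.inl ⟨hmax, hna⟩)
  have hadj : ∀ u v, u ≠ v → G.degree u = Fintype.card V - 2 →
      G.degree v = Fintype.card V - 2 → G.Adj u v := by
    intro u v h1 h2 h3
    by_contra h4
    exact hna ⟨u, v, h1, h2, h3, h4⟩
  by_cases hcond : AdjacentCondition G
  · exact Or.inr (Or.inr hcond)
  left
  have hz : ∀ u v, u ≠ v → G.degree u = Fintype.card V - 2 → G.degree v = Fintype.card V - 2 →
      ∀ z, ¬ G.Adj u z → ¬ G.Adj v z → False := fun u v h1 h2 h3 z h4 h5 =>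
    hcond ⟨hmax, hadj, u, v, h1, h2, h3, Or.inl ⟨z, not_or.2 ⟨h4, h5⟩⟩⟩
  have huv' := hadj u v huv hu hv
  obtain ⟨y, hyu, hy⟩ := exists_unique_nonneighbor (by omega) hu
  obtain ⟨x, hxv, hx⟩ := exists_unique_nonneighbor (by omega) hv
  have hyv : y ≠ v := fun e => ((hy v).1 huv').2 e.symm
  have hxu : x ≠ u := fun e => ((hx u).1 huv'.symm).2 e.symm
  have huy : ¬ G.Adj u y := fun h => ((hy y).1 h).2 rfl
  have hvx : ¬ G.Adj v x := fun h => ((hx x).1 h).2 rfl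
  have hxy : x ≠ y := fun e => hz u v huv hu hv x (e ▸ huy) hvx
  have hxm : x ∈ ({u, v} : Set V)ᶜ := by simp [hxu, hxv]
  have hym : y ∈ ({u, v} : Set V)ᶜ := by simp [hyu, hyv]
  have hnr : ¬ (G.induce ({u, v} : Set V)ᶜ).Reachable ⟨x, hxm⟩ ⟨y, hym⟩ := fun h =>
    hcond ⟨hmax, hadj, u, v, huv, hu, hv, Or.inr ⟨x, y, hxy,
      ⟨(hy x).2 ⟨hxu, hxy⟩, not_or.2 ⟨hxv, hvx⟩⟩,
      ⟨(hx y).2 ⟨hyv, hxy.symm⟩, not_or.2 ⟨hyu, huy⟩⟩, hxm, hym, h⟩⟩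
  have hdeg3 : ∀ t, t ≠ u → t ≠ v → G.degree t ≤ Fintype.card V - 3 := by
    intro t htu htv
    by_contra hlt
    have ht : G.degree t = Fintype.card V - 2 := by
      have := hdeg t
      omega
    -- A third vertex of degree `n - 2` would be a common neighbour of `x` and `y`.
    have htx : G.Adj t x := by
      by_contra h
      exact hz v t htv.symm hv ht x hvx h
    have hty : G.Adj t y := by
      by_contra h
      exact hz u t htu.symm hu ht y huy h
    have htm : t ∈ ({u, v} : Set V)ᶜ := by simp [htu, htv]
    refine hnr (SimpleGraph.Reachable.trans (v := ⟨t, htm⟩) ?_ ?_) <;>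
      refine SimpleGraph.Adj.reachable ?_
    · exact htx.symm
    · exact hty
  refine rd_le_of_disconnected (u := u) (v := v) (x := x) (y := y) ?_ huv hy hx hxu hxv hyu hyv
    {t | ∃ ht : t ∈ ({u, v} : Set V)ᶜ, (G.induce ({u, v} : Set V)ᶜ).Reachable ⟨x, hxm⟩ ⟨t, ht⟩}
    ?_ ?_ ⟨hxm, SimpleGraph.Reachable.refl _⟩ (fun ⟨_, h⟩ => hnr h) ?_ ?_
  · rw [Nat.card_eq_fintype_card]
    omega
  · rintro ⟨h, -⟩
    exact h (Or.inl rfl)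
  · rintro ⟨h, -⟩
    exact h (Or.inr rfl)
  · rintro a ⟨ha, hr⟩ b hab
    by_cases hbu : b = u
    · exact Or.inr (Or.inl hbu)
    by_cases hbv : b = v
    · exact Or.inr (Or.inr hbv)
    have hbm : b ∈ ({u, v} : Set V)ᶜ := by simp [hbu, hbv]
    have hab' : (G.induce ({u, v} : Set V)ᶜ).Adj ⟨a, ha⟩ ⟨b, hbm⟩ := hab
    exact Or.inl ⟨hbm, hr.trans hab'.reachable⟩
  · intro t htu htv
    rw [ncard_neighborSet_eq_degree]
    exact hdeg3 t htu htv

end Degrees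

/-! ### The extremal graphs -/

namespace IsLinkedPair

variable {V : Type*} {G : SimpleGraph V} {u v x y : V}

theorem ne_ends (h : IsLinkedPair G u v x y) : (x ≠ u ∧ x ≠ v) ∧ y ≠ u ∧ y ≠ v := by
  obtain ⟨hx, hy, -⟩ := h.reachable
  exact ⟨by simpa [not_or] using hx, by simpa [not_or] using hy⟩

theorem swap (h : IsLinkedPair G u v x y) : IsLinkedPair G v u y x := by
  refine ⟨h.ne.symm, h.adj_right, h.adj_left, ?_⟩
  rw [Set.pair_comm]
  obtain ⟨hx, hy, hr⟩ := h.reachable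
  exact ⟨hy, hx, hr.symm⟩

/-- The vertex `x` has a neighbour besides `u` and `v`: the next vertex on the way to `y`, if
`x ≠ y`; any neighbour, if `x = y`. -/
theorem exists_adj (hG : G.Connected) (h : IsLinkedPair G u v x y) :
    ∃ t, t ≠ u ∧ t ≠ v ∧ G.Adj x t := by
  by_cases hxy : x = y
  · have : Nontrivial V := ⟨u, v, h.ne⟩
    obtain ⟨t, ht⟩ := hG.preconnected.exists_adj_of_nontrivial x
    refine ⟨t, ?_, ?_, ht⟩
    · rintro rfl
      exact ((h.adj_left x).1 ht.symm).2 hxy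
    · rintro rfl
      exact ((h.adj_right x).1 ht.symm).2 rfl
  · obtain ⟨hx, hy, ⟨p⟩⟩ := h.reachable
    obtain ⟨d, -, hd1, -⟩ := p.exists_boundary_dart {⟨x, hx⟩} rfl
      (fun e => hxy (congrArg Subtype.val e).symm)
    have hadj : G.Adj d.fst.1 d.snd.1 := d.adj
    rw [Set.mem_singleton_iff.1 hd1] at hadj
    have h2 := d.snd.2
    exact ⟨d.snd.1, fun e => h2 (Or.inl e), fun e => h2 (Or.inr e), hadj⟩

/-- The path on four vertices is the only graph on four vertices that is connected and has a
connected complement, and its inner vertices are not linked. -/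
theorem five_le_card [Fintype V] (hG : G.Connected) (hGc : Gᶜ.Connected)
    (h : IsLinkedPair G u v x y) : 5 ≤ Fintype.card V := by
  classical
  obtain ⟨⟨hxu, hxv⟩, hyu, hyv⟩ := h.ne_ends
  have hcu : ∀ t, Gᶜ.Adj u t → t = y := by
    rintro t ⟨h1, h2⟩
    by_contra e
    exact h2 ((h.adj_left t).2 ⟨h1.symm, e⟩)
  have hcv : ∀ t, Gᶜ.Adj v t → t = x := by
    rintro t ⟨h1, h2⟩
    by_contra e
    exact h2 ((h.adj_right t).2 ⟨h1.symm, e⟩)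
  obtain ⟨t, htu, htv, hxt⟩ := h.exists_adj hG
  by_cases hty : t = y
  · subst hty
    -- The set `{u, t}` with `t = y` is not closed in the complement, so `t` has a further
    -- neighbour there.
    have hne : ∃ s, Gᶜ.Adj t s ∧ s ≠ u ∧ s ≠ t := by
      by_contra hno
      push Not at hno
      have hv := mem_of_connected hGc (A := {u, t}) (a := u) (by
        rintro a (rfl | rfl) b hab
        · exact Or.inr (hcu b hab)
        · by_cases hb : b = u
          · exact Or.inl hb
          · exact Or.inr (hno b hab hb)) (Or.inl rfl) v
      rcases hv with hv | hv
      · exact h.ne hv.symm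
      · exact htv hv.symm
    obtain ⟨s, hts, hsu, hst⟩ := hne
    have hsv : s ≠ v := by
      rintro rfl
      exact hxt.ne (hcv t hts.symm).symm
    have hsx : s ≠ x := by
      rintro rfl
      exact hts.2 hxt.symm
    have h5 : ({u, v, x, t, s} : Finset V).card = 5 := by
      rw [Finset.card_insert_of_notMem, Finset.card_insert_of_notMem, Finset.card_insert_of_notMem,
        Finset.card_pair hst.symm]
      all_goals simp [h.ne, hxu.symm, hxv.symm, htu.symm, htv.symm, hsu.symm, hsv.symm, hxt.ne,
        hsx.symm]
    exact h5 ▸ Finset.card_le_univ _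
  · have : Nontrivial V := ⟨u, v, h.ne⟩
    obtain ⟨s, hts⟩ := hGc.preconnected.exists_adj_of_nontrivial t
    have hsu : s ≠ u := by
      rintro rfl
      exact hty (hcu t hts.symm)
    have hsv : s ≠ v := by
      rintro rfl
      exact hxt.ne (hcv t hts.symm).symm
    have hsx : s ≠ x := by
      rintro rfl
      exact hts.2 hxt.symm
    have h5 : ({u, v, x, t, s} : Finset V).card = 5 := by
      rw [Finset.card_insert_of_notMem, Finset.card_insert_of_notMem, Finset.card_insert_of_notMem,
        Finset.card_pair hts.ne]
      all_goals simp [h.ne, hxu.symm, hxv.symm, htu.symm, htv.symm, hsu.symm, hsv.symm, hxt.ne,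
        hsx.symm]
    exact h5 ▸ Finset.card_le_univ _

end IsLinkedPair

section Extremal

variable {V : Type*} [Fintype V] {G : SimpleGraph V}

/-- The vertices of degree `n - 2` are pendant in the complement. -/
theorem subsingleton_neighborSet_compl [DecidableEq V] [DecidableRel G.Adj]
    (hn : 2 ≤ Fintype.card V) {u : V} (hu : G.degree u = Fintype.card V - 2) :
    (Gᶜ.neighborSet u).Subsingleton := by
  obtain ⟨y, -, hy⟩ := exists_unique_nonneighbor hn hu
  have key : ∀ t ∈ Gᶜ.neighborSet u, t = y := by
    rintro t ⟨hut, hadj⟩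
    by_contra h
    exact hadj ((hy t).2 ⟨hut.symm, h⟩)
  exact fun a ha b hb => (key a ha).trans (key b hb).symm

/-- Two nonadjacent vertices of degree `n - 2` form a component of the complement. -/
theorem NonadjacentCondition.not_compl_connected [DecidableEq V] [DecidableRel G.Adj]
    (hn : 4 ≤ Fintype.card V) (h : NonadjacentCondition G) : ¬ Gᶜ.Connected := by
  intro hGc
  obtain ⟨-, u, v, huv, hu, hv, hadj⟩ := h
  have hu' := subsingleton_neighborSet_compl (by omega) hu
  have hv' := subsingleton_neighborSet_compl (by omega) hv
  have huv' : Gᶜ.Adj u v := ⟨huv, hadj⟩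
  have hall : ∀ t, t ∈ ({u, v} : Set V) := by
    refine mem_of_connected hGc (a := u) ?_ (Or.inl rfl)
    rintro a (rfl | rfl) b hab
    · exact Or.inr (hu' hab huv')
    · exact Or.inl (hv' hab huv'.symm)
  have h1 := Set.ncard_le_ncard (fun t _ => hall t : Set.univ ⊆ ({u, v} : Set V)) (Set.toFinite _)
  rw [Set.ncard_univ, Nat.card_eq_fintype_card, Set.ncard_pair huv] at h1
  omega

/-- The vertices of `P` are pendant in the complement, so that only the other vertices count. -/
theorem rd_compl_le [DecidableEq V] [DecidableRel G.Adj] (hn : 2 ≤ Fintype.card V) (P : Set V)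
    (hP : ∀ p ∈ P, G.degree p = Fintype.card V - 2) (hlt : 2 ≤ Pᶜ.ncard) :
    rd Gᶜ ≤ Pᶜ.ncard - 1 := by
  have : Nonempty V := Fintype.card_pos_iff.1 (by omega)
  refine rd_le_of_ncard_neighborSet_le (by omega) P
    (fun p hp => subsingleton_neighborSet_compl hn (hP p hp)) (fun t ht => ?_) (by omega)
  have := ncard_neighborSet_restrictEdges_lt_ncard Gᶜ (T := Pᶜ) ht
  omega

/-- A vertex of degree two that is not special has exactly the neighbours `u` and `v`. Two such
vertices are adjacent in the complement and have `n - 4` common neighbours there. -/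
theorem card_sub_three_le_rd_compl [DecidableEq V] [DecidableRel G.Adj]
    (hn : 5 ≤ Fintype.card V) {u v : V} (huv : u ≠ v) (hu : G.degree u = Fintype.card V - 2)
    (hv : G.degree v = Fintype.card V - 2)
    (h : 2 ≤ {w : V | G.degree w = 2 ∧ ¬ IsSpecialVertex G u v w}.ncard) :
    Fintype.card V - 3 ≤ rd Gᶜ := by
  obtain ⟨p, q, hp, hq, hpq⟩ := (Set.one_lt_ncard_iff (Set.toFinite _)).1 h
  have key : ∀ w, G.degree w = 2 ∧ ¬ IsSpecialVertex G u v w →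
      w ≠ u ∧ w ≠ v ∧ ∀ t, G.Adj w t → t = u ∨ t = v := by
    rintro w ⟨hw, hs⟩
    have hwu : w ≠ u := by
      rintro rfl
      omega
    have hwv : w ≠ v := by
      rintro rfl
      omega
    rw [IsSpecialVertex, not_or, not_or] at hs
    have h3 : G.Adj u w ∨ G.Adj v w := not_not.1 hs.2.2
    have h1 : G.Adj u w → G.Adj v w := fun h => by
      by_contra h'
      exact hs.1 ⟨h, fun e => e.elim hwv h'⟩
    have h2 : G.Adj v w → G.Adj u w := fun h => by
      by_contra h'
      exact hs.2.1 ⟨h, fun e => e.elim hwu h'⟩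
    have hsub : ({u, v} : Set V) ⊆ G.neighborSet w := by
      rintro t (rfl | rfl)
      · exact (h3.elim id h2).symm
      · exact (h3.elim h1 id).symm
    have heq := Set.eq_of_subset_of_ncard_le hsub
      (by rw [ncard_neighborSet_eq_degree, hw, Set.ncard_pair huv]) (Set.toFinite _)
    refine ⟨hwu, hwv, fun t ht => ?_⟩
    have : t ∈ ({u, v} : Set V) := heq ▸ ht
    exact this
  obtain ⟨hpu, hpv, hp'⟩ := key p hp
  obtain ⟨hqu, hqv, hq'⟩ := key q hq
  have hpq' : Gᶜ.Adj p q := ⟨hpq, fun h => (hp' q h).elim hqu hqv⟩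
  have h1 := le_rd_of_common_neighbors (C := ({p, q, u, v} : Set V)ᶜ) hpq' (by
    intro t ht
    simp only [Set.mem_compl_iff, Set.mem_insert_iff, Set.mem_singleton_iff, not_or] at ht
    exact ⟨⟨fun e => ht.1 e.symm, fun h => (hp' t h).elim ht.2.2.1 ht.2.2.2⟩,
      ⟨fun e => ht.2.1 e.symm, fun h => (hq' t h).elim ht.2.2.1 ht.2.2.2⟩⟩)
  have h2 : ({p, q, u, v} : Set V).ncard ≤ 4 :=
    (Set.ncard_insert_le _ _).trans (Nat.succ_le_succ ((Set.ncard_insert_le _ _).trans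
      (Nat.succ_le_succ ((Set.ncard_insert_le _ _).trans (by simp)))))
  rw [Set.ncard_compl, Nat.card_eq_fintype_card] at h1
  omega

/-- The complement of `G` without its pendant vertices `u` and `v` has at most `n - 4` as rainbow
disconnection number unless it has two vertices of full degree, and these have in `G` the
neighbours `u` and `v` only. -/
theorem two_le_ncard_of_le_rd_compl [DecidableEq V] [DecidableRel G.Adj] (hG : G.Connected)
    (hn : 5 ≤ Fintype.card V) {u v x y : V} (h : IsLinkedPair G u v x y)
    (hu : G.degree u = Fintype.card V - 2) (hv : G.degree v = Fintype.card V - 2)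
    (hrd : Fintype.card V - 3 ≤ rd Gᶜ) :
    2 ≤ {w : V | G.degree w = 2 ∧ ¬ IsSpecialVertex G u v w}.ncard := by
  have : Nonempty V := ⟨u⟩
  by_contra hlt
  have hPc : ({u, v} : Set V)ᶜ.ncard = Fintype.card V - 2 := by
    rw [Set.ncard_compl, Nat.card_eq_fintype_card, Set.ncard_pair h.ne]
  have hP : ∀ p ∈ ({u, v} : Set V), (Gᶜ.neighborSet p).Subsingleton := by
    rintro p (rfl | rfl)
    · exact subsingleton_neighborSet_compl (by omega) hu
    · exact subsingleton_neighborSet_compl (by omega) hv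
  let d : V → ℕ := fun t => ((restrictEdges Gᶜ ({u, v} : Set V)ᶜ).neighborSet t).ncard
  have hd : ∀ t, t ∉ ({u, v} : Set V) → d t ≤ Fintype.card V - 3 := by
    intro t ht
    have h1 : d t < ({u, v} : Set V)ᶜ.ncard := ncard_neighborSet_restrictEdges_lt_ncard Gᶜ ht
    omega
  have hfull : ∀ t, t ∉ ({u, v} : Set V) → d t = Fintype.card V - 3 →
      t ∈ {w : V | G.degree w = 2 ∧ ¬ IsSpecialVertex G u v w} := by
    intro t ht hdt
    have htu : t ≠ u := fun e => ht (Or.inl e)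
    have htv : t ≠ v := fun e => ht (Or.inr e)
    have hsub : (restrictEdges Gᶜ ({u, v} : Set V)ᶜ).neighborSet t ⊆ ({u, v} : Set V)ᶜ \ {t} :=
      fun s hs => ⟨hs.2.2, fun e => hs.1.1 (Eq.symm e)⟩
    have heq := Set.eq_of_subset_of_ncard_le hsub (by
      rw [Set.ncard_sdiff_singleton_of_mem ht, hPc]
      change _ ≤ d t
      omega) (Set.toFinite _)
    have hnb : ∀ s, G.Adj t s → s = u ∨ s = v := by
      intro s hs
      by_contra hsP
      have : s ∈ (restrictEdges Gᶜ ({u, v} : Set V)ᶜ).neighborSet t :=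
        heq ▸ ⟨hsP, fun e => hs.ne (Eq.symm e)⟩
      exact this.1.2 hs
    -- The special vertices `x` and `y` have a neighbour besides `u` and `v`.
    have htx : t ≠ x := by
      rintro rfl
      obtain ⟨s, hsu, hsv, hs⟩ := h.exists_adj hG
      exact (hnb s hs).elim hsu hsv
    have hty : t ≠ y := by
      rintro rfl
      obtain ⟨s, hsv, hsu, hs⟩ := h.swap.exists_adj hG
      exact (hnb s hs).elim hsu hsv
    have hut : G.Adj u t := (h.adj_left t).2 ⟨htu, hty⟩
    have hvt : G.Adj v t := (h.adj_right t).2 ⟨htv, htx⟩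
    refine ⟨?_, ?_⟩
    · rw [← ncard_neighborSet_eq_degree, ← Set.ncard_pair h.ne]
      congr 1
      ext s
      refine ⟨hnb s, ?_⟩
      rintro (rfl | rfl)
      · exact hut.symm
      · exact hvt.symm
    · rintro (hs | hs | hs)
      · exact hs.2 (Or.inr hvt)
      · exact hs.2 (Or.inr hut)
      · exact hs (Or.inl hut)
  have hle : rd Gᶜ ≤ Fintype.card V - 4 := by
    by_cases hex : ∃ w, w ∉ ({u, v} : Set V) ∧ d w = Fintype.card V - 3
    · obtain ⟨w, hw, hdw⟩ := hex
      refine rd_le_of_center (by omega) {u, v} hP w hw (fun t ht htw => ?_) ?_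
      · have h1 : d t ≤ Fintype.card V - 3 := hd t ht
        by_cases h2 : d t = Fintype.card V - 3
        · exact absurd ((Set.one_lt_ncard_iff (Set.toFinite _)).2
            ⟨t, w, hfull t ht h2, hfull w hw hdw, htw⟩) hlt
        · change d t ≤ _
          omega
      · change _ ≤ d w + 3
        omega
    · push Not at hex
      refine rd_le_of_ncard_neighborSet_le (by omega) {u, v} hP (fun t ht => ?_) (by omega)
      have h1 := hd t ht
      have h2 := hex t ht
      change d t ≤ _
      omega
  omega

/-- The extremal conditions say that `G` has the largest possible rainbow disconnection number,
and its complement the second largest. -/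
theorem extremalConditions_iff [DecidableEq V] [DecidableRel G.Adj] (hn : 4 ≤ Fintype.card V)
    (hG : G.Connected) (hGc : Gᶜ.Connected) :
    ExtremalConditions G ↔ rd G = Fintype.card V - 2 ∧ rd Gᶜ = Fintype.card V - 3 := by
  have : Nonempty V := hG.nonempty
  have hdeg := fun v => degree_le_of_compl_connected hGc (by omega : 2 ≤ Fintype.card V) v
  have hpair : ∀ {u v : V}, u ≠ v → ({u, v} : Set V)ᶜ.ncard = Fintype.card V - 2 := by
    intro u v huv
    rw [Set.ncard_compl, Nat.card_eq_fintype_card, Set.ncard_pair huv]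
  constructor
  · rintro ⟨hcond, u, v, huv, hset, hspecial⟩
    have hadj := hcond.resolve_left fun h => h.not_compl_connected hn hGc
    obtain ⟨u', v', x, y, -, -, hl⟩ := hadj.exists_isLinkedPair (by omega)
    have h5 := hl.five_le_card hG hGc
    have hu : G.degree u = Fintype.card V - 2 := by
      have : u ∈ {w : V | G.degree w = Fintype.card V - 2} := hset ▸ Or.inl rfl
      exact this
    have hv : G.degree v = Fintype.card V - 2 := by
      have : v ∈ {w : V | G.degree w = Fintype.card V - 2} := hset ▸ Or.inr rfl
      exact this
    refine ⟨le_antisymm (rd_le_of_degree_le (by omega) hdeg (by omega)) hl.card_sub_two_le_rd,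
      le_antisymm ?_ (card_sub_three_le_rd_compl h5 huv hu hv hspecial)⟩
    have h1 := rd_compl_le (G := G) (by omega) {u, v} (by rintro p (rfl | rfl) <;> assumption)
      (by rw [hpair huv]; omega)
    rw [hpair huv] at h1
    omega
  · rintro ⟨hrd, hrdc⟩
    have hcond : NonadjacentCondition G ∨ AdjacentCondition G :=
      (rd_le_or_condition hn hdeg).resolve_left (by omega)
    have hadj := hcond.resolve_left fun h => h.not_compl_connected hn hGc
    obtain ⟨u, v, x, y, hu, hv, hl⟩ := hadj.exists_isLinkedPair (by omega)
    have h5 := hl.five_le_card hG hGc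
    refine ⟨hcond, u, v, hl.ne, ?_, two_le_ncard_of_le_rd_compl hG h5 hl hu hv hrdc.ge⟩
    ext r
    refine ⟨fun hr => ?_, by rintro (rfl | rfl) <;> assumption⟩
    by_contra hruv
    have hcard : (insert r ({u, v} : Set V))ᶜ.ncard = Fintype.card V - 3 := by
      rw [Set.ncard_compl, Nat.card_eq_fintype_card, Set.ncard_insert_of_notMem hruv,
        Set.ncard_pair hl.ne]
    -- At `n = 5` the remaining graph has two vertices, which is just enough for one colour.
    have h1 := rd_compl_le (G := G) (by omega) (insert r {u, v})
      (by rintro p (rfl | rfl | rfl) <;> assumption) (by rw [hcard]; omega)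
    omega

end Extremal

theorem mainTheorem5 {V : Type*} [Fintype V] [DecidableEq V] (G : SimpleGraph V)
    [DecidableRel G.Adj] (hn : 4 ≤ Fintype.card V) (hG : G.Connected) (hGc : Gᶜ.Connected) :
    (((rd G : ℤ) + (rd Gᶜ : ℤ) = 2 * (Fintype.card V : ℤ) - 5) ↔
      (ExtremalConditions G ∨ ExtremalConditions Gᶜ)) ∧
    (((rd G : ℤ) * (rd Gᶜ : ℤ) = ((Fintype.card V : ℤ) - 2) * ((Fintype.card V : ℤ) - 3)) ↔
      (ExtremalConditions G ∨ ExtremalConditions Gᶜ)) := by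
  have : Nonempty V := hG.nonempty
  have hGcc : Gᶜᶜ.Connected := by rwa [compl_compl]
  have h1 : rd G ≤ Fintype.card V - 2 :=
    rd_le_of_degree_le (by omega) (degree_le_of_compl_connected hGc (by omega)) (by omega)
  have h2 : rd Gᶜ ≤ Fintype.card V - 2 :=
    rd_le_of_degree_le (by omega) (degree_le_of_compl_connected hGcc (by omega)) (by omega)
  have e2 := extremalConditions_iff (G := Gᶜ) hn hGc hGcc
  rw [compl_compl] at e2
  rw [extremalConditions_iff hn hG hGc, e2]
  obtain ⟨n, hcard⟩ := Nat.exists_eq_add_of_le hn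
  rw [hcard] at h1 h2 ⊢
  generalize rd G = a at *
  generalize rd Gᶜ = b at *
  push_cast
  have e3 : 4 + n - 2 = n + 2 := by omega
  have e4 : 4 + n - 3 = n + 1 := by omega
  rw [e3] at h1 h2 ⊢
  rw [e4]
  refine ⟨by omega, ?_, ?_⟩
  · intro h
    have h3 : a * b = (n + 2) * (n + 1) := by
      zify
      rw [h]
      ring
    -- If neither factor is `n - 2`, the product is too small.
    rcases Nat.lt_or_ge a (n + 2) with ha | ha
    · rcases Nat.lt_or_ge b (n + 2) with hb | hb
      · have := Nat.mul_le_mul (Nat.le_of_lt_succ ha) (Nat.le_of_lt_succ hb)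
        nlinarith
      · obtain rfl : b = n + 2 := by omega
        refine Or.inr ⟨rfl, ?_⟩
        rw [mul_comm] at h3
        exact Nat.eq_of_mul_eq_mul_left (by omega) h3
    · obtain rfl : a = n + 2 := by omega
      exact Or.inl ⟨rfl, Nat.eq_of_mul_eq_mul_left (by omega) h3⟩
  · rintro (⟨rfl, rfl⟩ | ⟨rfl, rfl⟩) <;> push_cast <;> ring
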